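/- All digraphs are finite, without loops or parallel arcs (opposite arcs are allowed), and $[u,v]$ denotes the pair of arcs $\{uv,vu\}$. The dichromatic number $\vec\chi(D)$ is the least number of colours in a vertex colouring of $D$ without monochromatic directed cycle; $\lambda(D)$ is the maximum, over ordered pairs of distinct vertices $x,y$, of the number of pairwise arc-disjoint directed paths from $x$ to $y$. A digraph $D$ is *$k$-extremal* if it is strongly connected, its underlying graph is connected and has no cutvertex, and $\vec\chi(D)=\lambda(D)+1=k+1$. Let $T$ be a tree with edges $u_1v_1,\dots,u_nv_n$, $n\ge 1$, embedded in the plane, and let $C=(x_1,\dots,x_\ell)$ be the circular ordering of the leaves of $T$ given by the embedding (the order in which the leaves are met on a walk around the drawing of $T$). For $i=1,\dots,n$ let $D_i$ be a digraph with $V(D_i)\cap V(T)=\{u_i,v_i\}$ and $[u_i,v_i]\subseteq A(D_i)$, such that the sets $V(D_i)\setminus\{u_i,v_i\}$ are pairwise disjoint. The *Hajós tree join* $T(D_1,\dots,D_n;C)$ is the digraph obtained from the union of the digraphs $D_i-[u_i,v_i]$ by adding the directed cycle $x_1\to x_2\to\dots\to x_\ell\to x_1$. **Lemma 6.7.** Let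 $k\ge 2$ and let $D=T(D_1,\dots,D_n;C)$ be a Hajós tree join. If every $D_i$ is $k$-extremal, then $D$ is $k$-extremal. If $k\ge 3$ and $D$ is $k$-extremal, then every $D_i$ is $k$-extremal. (So for $k\ge 3$, $D$ is $k$-extremal if and only if every $D_i$ is.) -/

import Mathlib

/-- A finite digraph with vertices in an ambient type `α`: a pair `(V, A)` of finite sets with
`A ⊆ (V × V) \ {(v, v)}`.  There are no loops and no parallel arcs; opposite arcs are allowed. -/
structure FinDigraph (α : Type*) where
  verts : Set α
  arcs : Set (α × α)
  finite_verts : verts.Finite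
  arcs_subset : ∀ a ∈ arcs, a.1 ∈ verts ∧ a.2 ∈ verts
  loopless : ∀ a ∈ arcs, a.1 ≠ a.2

namespace FinDigraph

variable {α : Type*}

/-- The list `p` of pairwise distinct vertices is a dipath with first vertex `x` and last
vertex `y`. -/
def IsDipath (D : FinDigraph α) (x y : α) (p : List α) : Prop :=
  p.head? = some x ∧ p.getLast? = some y ∧ p.Nodup ∧ (∀ z ∈ p, z ∈ D.verts) ∧
    p.IsChain (fun a b => (a, b) ∈ D.arcs)

/-- The pairs of consecutive elements of a list (the arcs traversed by a dipath). -/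
def pathArcs (p : List α) : List (α × α) := p.zip p.tail

/-- The list `c` of pairwise distinct vertices is a directed cycle `c₀ → c₁ → ⋯ → c₀`: a dipath
together with an arc from its last to its first vertex.  (Its length is at least two, because there
are no loops.) -/
def IsDicycle (D : FinDigraph α) (c : List α) : Prop :=
  ∃ x y, D.IsDipath x y c ∧ (y, x) ∈ D.arcs

/-- `D` is strong: there is a dipath from every vertex to every vertex. -/
def IsStrong (D : FinDigraph α) : Prop :=
  ∀ x ∈ D.verts, ∀ y ∈ D.verts, ∃ p, D.IsDipath x y p

/-- The underlying undirected graph, on the vertex set of `D`. -/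
def underlying (D : FinDigraph α) : SimpleGraph D.verts :=
  SimpleGraph.fromRel fun x y => ((x : α), (y : α)) ∈ D.arcs

/-- The underlying graph of `D` is connected and has no cutvertex, that is, deleting a vertex never
disconnects it. -/
def IsBiconnected (D : FinDigraph α) : Prop :=
  D.underlying.Connected ∧ ∀ v : D.verts, (D.underlying.induce {v}ᶜ).Preconnected

/-- `φ` is a dicolouring: every colour class induces an acyclic digraph, i.e. no directed cycle is
monochromatic. -/
def IsDicolouring (D : FinDigraph α) {k : ℕ} (φ : D.verts → Fin k) : Prop :=
  ∀ i : Fin k, ¬ ∃ c : List α, D.IsDicycle c ∧ ∀ z (hz : z ∈ D.verts), z ∈ c → φ ⟨z, hz⟩ = i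

/-- The dichromatic number: the least `k` such that `D` has a `k`-dicolouring. -/
noncomputable def dichromaticNumber (D : FinDigraph α) : ℕ :=
  sInf {k : ℕ | ∃ φ : D.verts → Fin k, D.IsDicolouring φ}

/-- `D` has `m` pairwise arc-disjoint dipaths from `x` to `y`. -/
def HasArcDisjointDipaths (D : FinDigraph α) (x y : α) (m : ℕ) : Prop :=
  ∃ P : Fin m → List α, (∀ i, D.IsDipath x y (P i)) ∧
    ∀ i j, i ≠ j → (pathArcs (P i)).Disjoint (pathArcs (P j))

/-- The local arc-connectivity from `x` to `y`, for distinct vertices `x` and `y`: the maximum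
number of pairwise arc-disjoint dipaths from `x` to `y` (at most the number of arcs). -/
noncomputable def localArcConn (D : FinDigraph α) (x y : α) : ℕ :=
  sSup {m : ℕ | D.HasArcDisjointDipaths x y m}

/-- The maximum local arc-connectivity over all pairs of distinct vertices. -/
noncomputable def maxLocalArcConn (D : FinDigraph α) : ℕ :=
  sSup {m : ℕ | ∃ x ∈ D.verts, ∃ y ∈ D.verts, x ≠ y ∧ m = D.localArcConn x y}

/-- `D` is `k`-extremal. -/
def IsExtremal (D : FinDigraph α) (k : ℕ) : Prop :=
  D.IsBiconnected ∧ D.IsStrong ∧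
    D.dichromaticNumber = D.maxLocalArcConn + 1 ∧ D.maxLocalArcConn + 1 = k + 1

end FinDigraph

/-- A leaf: a vertex with exactly one neighbour. -/
def SimpleGraph.IsLeafVertex {τ : Type*} (T : SimpleGraph τ) (x : τ) : Prop :=
  ∃! y, T.Adj x y

/-- A rotation system: a cyclic ordering of the neighbours around every vertex, given as a
permutation of the neighbours with a single cycle.  This is the combinatorial description of an
embedding in an oriented surface.  For a tree, every rotation system is one of an embedding in the
plane and every embedding in the plane has one (the anticlockwise order around each vertex). -/
structure RotationSystem {τ : Type*} (T : SimpleGraph τ) where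
  rot : ∀ x : τ, Equiv.Perm (T.neighborSet x)
  cyclic : ∀ (x : τ) (a b : T.neighborSet x), (rot x).SameCycle a b

namespace RotationSystem

variable {τ : Type*} {T : SimpleGraph τ}

/-- Walking around the drawing along a face: after the dart from `x` to `y` comes the dart from `y`
to the neighbour that follows `x` in the cyclic ordering around `y`. -/
def faceNext (R : RotationSystem T) (d : T.Dart) : T.Dart :=
  ⟨(d.snd, (R.rot d.snd ⟨d.fst, d.adj.symm⟩ : τ)), (R.rot d.snd ⟨d.fst, d.adj.symm⟩).2⟩

/-- `y` is the leaf that follows the leaf `x` in the natural circular ordering of the leaves: it is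
the first leaf that is met after `x` on the walk around the drawing of the tree. -/
def NextLeaf (R : RotationSystem T) (x y : τ) : Prop :=
  T.IsLeafVertex x ∧ T.IsLeafVertex y ∧
    ∃ (d : T.Dart) (m : ℕ), 0 < m ∧ d.fst = x ∧ (R.faceNext^[m] d).fst = y ∧
      ∀ j, 0 < j → j < m → ¬ T.IsLeafVertex (R.faceNext^[j] d).fst

end RotationSystem

/-- The data of a Hajós tree join `T(D₁, …, Dₙ; C)`. -/
structure HajosTree (α : Type*) (n : ℕ) where
  /-- the vertex set of the tree -/
  treeVerts : Set α
  /-- the tree `T` -/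
  T : SimpleGraph treeVerts
  isTree : T.IsTree
  /-- the edges of `T` are `u₁v₁, …, uₙvₙ`, and there is at least one -/
  u : Fin n → treeVerts
  v : Fin n → treeVerts
  n_pos : 0 < n
  edge_injective : Function.Injective fun i => s(u i, v i)
  range_edge : (Set.range fun i => s(u i, v i)) = T.edgeSet
  /-- the embedding of `T` in the plane -/
  R : RotationSystem T
  /-- the circular ordering `C = (x₁, …, x_ℓ)` of the leaves of `T` -/
  ℓ : ℕ
  C : Fin ℓ → treeVerts
  C_injective : Function.Injective C
  range_C : Set.range C = {x | T.IsLeafVertex x}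
  /-- the ordering is the natural one given by the embedding of `T` -/
  C_natural : ∀ j, R.NextLeaf (C j) (C (finRotate ℓ j))
  /-- the digraphs `D₁, …, Dₙ` -/
  D : Fin n → FinDigraph α
  verts_inter : ∀ i, (D i).verts ∩ treeVerts = {(u i : α), (v i : α)}
  digon : ∀ i, ((u i : α), (v i : α)) ∈ (D i).arcs ∧ ((v i : α), (u i : α)) ∈ (D i).arcs
  disjoint : ∀ i j, i ≠ j →
    ((D i).verts \ {(u i : α), (v i : α)}) ∩ ((D j).verts \ {(u j : α), (v j : α)}) = ∅

namespace HajosTree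

variable {α : Type*} {n : ℕ}

theorem leaf_mem (J : HajosTree α n) {x : J.treeVerts} (hx : J.T.IsLeafVertex x) :
    ∃ i, (x : α) ∈ (J.D i).verts := by
  obtain ⟨y, hy, -⟩ := hx
  have h : s(x, y) ∈ J.T.edgeSet := hy
  rw [← J.range_edge] at h
  obtain ⟨i, hi⟩ := h
  have hxi : (x : α) ∈ (J.D i).verts ∩ J.treeVerts := by
    rw [J.verts_inter]
    rcases Sym2.eq_iff.1 hi with ⟨h, -⟩ | ⟨-, h⟩ <;> simp [h]
  exact ⟨i, hxi.1⟩

theorem C_leaf (J : HajosTree α n) (j : Fin J.ℓ) : J.T.IsLeafVertex (J.C j) := by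
  have : J.C j ∈ Set.range J.C := ⟨j, rfl⟩
  rwa [J.range_C] at this

theorem C_ne_next (J : HajosTree α n) (j : Fin J.ℓ) : J.C j ≠ J.C (finRotate J.ℓ j) := by
  classical
  have hadj : J.T.Adj (J.u ⟨0, J.n_pos⟩) (J.v ⟨0, J.n_pos⟩) := by
    rw [← SimpleGraph.mem_edgeSet, ← J.range_edge]
    exact ⟨_, rfl⟩
  have : Nontrivial J.treeVerts := ⟨_, _, hadj.ne⟩
  have : Finite J.T.edgeSet := by
    rw [← J.range_edge]
    exact (Set.finite_range _).to_subtype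
  have hfin : (Set.range J.u ∪ Set.range J.v) = Set.univ := by
    refine Set.eq_univ_of_forall fun x => ?_
    obtain ⟨y, hy⟩ := J.isTree.connected.preconnected.exists_adj_of_nontrivial x
    have h : s(x, y) ∈ J.T.edgeSet := hy
    rw [← J.range_edge] at h
    obtain ⟨i, hi⟩ := h
    rcases Sym2.eq_iff.1 hi with ⟨h, -⟩ | ⟨-, h⟩
    · exact Or.inl ⟨i, h⟩
    · exact Or.inr ⟨i, h⟩
  have : Finite J.treeVerts := Set.finite_univ_iff.1 <| by
    rw [← hfin]
    exact (Set.finite_range _).union (Set.finite_range _)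
  have : Fintype J.treeVerts := Fintype.ofFinite _
  obtain ⟨w, hw, hd⟩ : ∃ w, w ≠ J.C j ∧ J.T.degree w = 1 := by
    obtain ⟨a, b, hab, ha, hb⟩ := J.isTree.exists_ne_and_degree_eq_one
    by_cases h : a = J.C j
    · exact ⟨b, fun hb' => hab (h.trans hb'.symm), hb⟩
    · exact ⟨a, h, ha⟩
  have hleaf : J.T.IsLeafVertex w := by
    obtain ⟨y, hy⟩ := SimpleGraph.degree_eq_one_iff_existsUnique_adj.1 hd
    exact ⟨y, hy⟩
  have hmem : w ∈ Set.range J.C := by rw [J.range_C]; exact hleaf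
  obtain ⟨i, rfl⟩ := hmem
  intro h
  have hfix := J.C_injective h
  rcases hl : J.ℓ with _ | _ | m
  · exact absurd j.2 (by omega)
  · have hi := i.2
    have hj := j.2
    exact hw (congrArg J.C (Fin.ext (by omega)))
  · have key : ∀ (l : ℕ) (j : Fin l), l = m + 2 → finRotate l j ≠ j := by
      rintro l j rfl h
      simp at h
    exact key _ j hl hfix.symm

/-- The Hajós tree join `T(D₁, …, Dₙ; C)`: take the digraphs `Dᵢ - [uᵢ, vᵢ]` and add the directed
cycle `C` through the leaves of `T`. -/
def join (J : HajosTree α n) : FinDigraph α where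
  verts := ⋃ i, (J.D i).verts
  arcs := (⋃ i, (J.D i).arcs \ {((J.u i : α), (J.v i : α)), ((J.v i : α), (J.u i : α))}) ∪
    Set.range fun j => ((J.C j : α), (J.C (finRotate J.ℓ j) : α))
  finite_verts := Set.finite_iUnion fun i => (J.D i).finite_verts
  arcs_subset := by
    rintro a (ha | ⟨j, rfl⟩)
    · obtain ⟨i, hi⟩ := Set.mem_iUnion.1 ha
      have := (J.D i).arcs_subset a hi.1
      exact ⟨Set.mem_iUnion.2 ⟨i, this.1⟩, Set.mem_iUnion.2 ⟨i, this.2⟩⟩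
    · exact ⟨Set.mem_iUnion.2 (J.leaf_mem (J.C_leaf j)),
        Set.mem_iUnion.2 (J.leaf_mem (J.C_leaf _))⟩
  loopless := by
    rintro a (ha | ⟨j, rfl⟩)
    · obtain ⟨i, hi⟩ := Set.mem_iUnion.1 ha
      exact (J.D i).loopless a hi.1
    · exact fun h => J.C_ne_next j (Subtype.ext h)

end HajosTree

/-! By `isExtremal_iff`, being `k`-extremal means: strong, biconnected, not `k`-dicolourable, and
any two vertices are separated by a cut of at most `k` arcs. Menger's theorem turns local
arc-connectivity into cuts. A vertex set that is minimal without `k`-dicolouring has only cuts of at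
least `k` arcs, because colourings of two parts joined by fewer arcs can be combined; this gives χ ≤
λ + 1 in general. In an extremal digraph the minimal set is everything, since an ear outside it
would push a cut beyond `k` arcs. Hence all cuts of an extremal digraph have at least `k` arcs.

A piece and the join are compared by the retraction `retr i`, which collapses what hangs at either
end of the `i`-th tree edge. Segments of the face walk between consecutive leaves share no dart, so
`C` crosses every tree edge exactly once in each direction. The two crossing arcs play the role of
the removed digon, and cuts of a piece pull back to cuts of the join that are no larger.

From pieces to join: a dicolouring of the join would give both ends of each tree edge the same
colour, making `C` monochromatic. Small cuts pull back. Each component left after deleting a vertex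
contains a leaf, and `C` ties the leaves together.

From join to pieces: a cut of a piece contains at most one digon arc, which can be exchanged for an
arc of the join outside that piece. If a piece were dicolourable, so would be the two collapsed
sides, by minimality; with three colours these can be permuted so as to glue to a dicolouring of the
join. -/

open Relation

/-! ### Menger's theorem for arcs, by augmenting unit flows. -/

section Menger

open scoped Classical

variable {α : Type*}

namespace FinDigraph

theorem pathArcs_cons_cons (a b : α) (l : List α) :
    pathArcs (a :: b :: l) = (a, b) :: pathArcs (b :: l) := rfl

theorem mem_of_mem_pathArcs {p : List α} {e : α × α} (h : e ∈ pathArcs p) :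
    e.1 ∈ p ∧ e.2 ∈ p := by
  obtain ⟨a, b⟩ := e
  have := List.of_mem_zip h
  exact ⟨this.1, List.mem_of_mem_tail this.2⟩

theorem rel_of_mem_pathArcs {r : α → α → Prop} : ∀ {p : List α}, p.IsChain r →
    ∀ e ∈ pathArcs p, r e.1 e.2
  | [], _, e, he => by simp [pathArcs] at he
  | [a], _, e, he => by simp [pathArcs] at he
  | a :: b :: l, h, e, he => by
    rw [pathArcs_cons_cons] at he
    rw [List.isChain_cons_cons] at h
    rcases List.mem_cons.1 he with rfl | he
    · exact h.1
    · exact rel_of_mem_pathArcs h.2 e he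

/-- A chain that starts inside `X` and ends outside `X` has an arc leaving `X`. -/
theorem exists_pathArcs_leaving {X : Set α} : ∀ {p : List α} {x y : α}, p.head? = some x →
    p.getLast? = some y → x ∈ X → y ∉ X → ∃ e ∈ pathArcs p, e.1 ∈ X ∧ e.2 ∉ X
  | [], x, y, h, _, _, _ => by simp at h
  | [a], x, y, h, h', hx, hy => by
    simp at h h'; subst h h'; exact absurd hx hy
  | a :: b :: l, x, y, h, h', hx, hy => by
    simp at h; subst h
    by_cases hb : b ∈ X
    · obtain ⟨e, he, h1⟩ := exists_pathArcs_leaving (p := b :: l) (x := b) rfl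
        (by simpa using h') hb hy
      exact ⟨e, by rw [pathArcs_cons_cons]; exact List.mem_cons_of_mem _ he, h1⟩
    · exact ⟨(a, b), by simp [pathArcs_cons_cons], hx, hb⟩

end FinDigraph

/-- A reachable vertex is reached by a chain without repetitions. -/
theorem exists_nodup_chain_of_reflTransGen {r : α → α → Prop} {a b : α}
    (h : ReflTransGen r a b) :
    ∃ l, (a :: l).Nodup ∧ (a :: l).IsChain r ∧ (a :: l).getLast? = some b := by
  induction h using ReflTransGen.head_induction_on with
  | refl => exact ⟨[], by simp⟩
  | @head a c hac _ ih =>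
    obtain ⟨l, hn, hc, hl⟩ := ih
    by_cases ha : a ∈ c :: l
    · obtain ⟨s, t, hst⟩ := List.append_of_mem ha
      have hsuf : (a :: t) <:+ (c :: l) := ⟨s, hst.symm⟩
      refine ⟨t, hn.sublist hsuf.sublist, hc.suffix hsuf, ?_⟩
      rw [hst] at hl
      simpa [List.getLast?_append] using hl
    · exact ⟨c :: l, List.nodup_cons.2 ⟨ha, hn⟩, List.isChain_cons_cons.2 ⟨hac, hc⟩, by
        simpa using hl⟩

theorem reflTransGen_of_chain {r : α → α → Prop} : ∀ {p : List α} {x y : α},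
    p.head? = some x → p.getLast? = some y → p.IsChain r → ReflTransGen r x y
  | [], x, y, h, _, _ => by simp at h
  | [a], x, y, h, h', _ => by
    simp at h h'; subst h h'; exact .refl
  | a :: b :: l, x, y, h, h', hc => by
    simp at h; subst h
    rw [List.isChain_cons_cons] at hc
    exact .head hc.1 (reflTransGen_of_chain (p := b :: l) rfl (by simpa using h') hc.2)

/-- The indicator function of a vertex. -/
noncomputable def unitAt (a w : α) : ℤ := if a = w then 1 else 0

theorem sum_unitAt (S : Finset α) (a : α) :
    ∑ w ∈ S, unitAt a w = if a ∈ S then 1 else 0 := by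
  simp only [unitAt, Finset.sum_ite_eq]

/-- Out-degree minus in-degree of `w` in a set `F` of arcs. -/
noncomputable def netOut (F : Finset (α × α)) (w : α) : ℤ :=
  ∑ e ∈ F, (unitAt e.1 w - unitAt e.2 w)

/-- `F ⊆ A` is a unit-capacity flow of value `m` from `x` to `y`. -/
structure IsUnitFlow (A : Finset (α × α)) (x y : α) (F : Finset (α × α)) (m : ℕ) : Prop where
  subset : F ⊆ A
  net : ∀ w, netOut F w = m * (unitAt x w - unitAt y w)

theorem netOut_insert {F : Finset (α × α)} {e : α × α} (h : e ∉ F) (w : α) :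
    netOut (insert e F) w =
      netOut F w + (unitAt e.1 w - unitAt e.2 w) := by
  rw [netOut, Finset.sum_insert h, netOut]; ring

theorem netOut_erase {F : Finset (α × α)} {e : α × α} (h : e ∈ F) (w : α) :
    netOut (F.erase e) w =
      netOut F w - (unitAt e.1 w - unitAt e.2 w) := by
  rw [netOut, Finset.sum_erase_eq_sub h, netOut]

/-- The value of a flow is its net amount through any cut. -/
theorem IsUnitFlow.value_eq {A F : Finset (α × α)} {x y : α} {m : ℕ} (h : IsUnitFlow A x y F m)
    {X : Set α} (hx : x ∈ X) (hy : y ∉ X) :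
    (m : ℤ) = ({e ∈ (F : Set (α × α)) | e.1 ∈ X ∧ e.2 ∉ X}).ncard -
      ({e ∈ (F : Set (α × α)) | e.1 ∉ X ∧ e.2 ∈ X}).ncard := by
  -- The set `X` may be infinite; only the ends of arcs of `F`, together with `x` and `y`,
  -- contribute to the double count.
  let V : Finset α := F.image Prod.fst ∪ F.image Prod.snd ∪ {x, y}
  have h1 : ∑ w ∈ V.filter (· ∈ X), netOut F w = m := by
    simp only [h.net]
    rw [← Finset.mul_sum, Finset.sum_sub_distrib, sum_unitAt, sum_unitAt]
    simp [V, hx, hy]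
  have h2 : ∑ w ∈ V.filter (· ∈ X), netOut F w =
      ∑ e ∈ F, ((if e.1 ∈ X then 1 else 0) - (if e.2 ∈ X then 1 else 0)) := by
    simp only [netOut]
    rw [Finset.sum_comm]
    refine Finset.sum_congr rfl fun e he => ?_
    have e1 : e.1 ∈ V := by
      simp only [V, Finset.mem_union, Finset.mem_image]
      exact .inl (.inl ⟨e, he, rfl⟩)
    have e2 : e.2 ∈ V := by
      simp only [V, Finset.mem_union, Finset.mem_image]
      exact .inl (.inr ⟨e, he, rfl⟩)
    rw [Finset.sum_sub_distrib, sum_unitAt, sum_unitAt]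
    simp [e1, e2]
  have c1 : {e ∈ (F : Set (α × α)) | e.1 ∈ X ∧ e.2 ∉ X} =
      ((F.filter fun e => e.1 ∈ X ∧ e.2 ∉ X : Finset (α × α)) : Set (α × α)) := by ext; simp
  have c2 : {e ∈ (F : Set (α × α)) | e.1 ∉ X ∧ e.2 ∈ X} =
      ((F.filter fun e => e.1 ∉ X ∧ e.2 ∈ X : Finset (α × α)) : Set (α × α)) := by ext; simp
  rw [← h1, h2, c1, c2, Set.ncard_coe_finset, Set.ncard_coe_finset, Finset.card_filter,
    Finset.card_filter]
  push_cast
  rw [← Finset.sum_sub_distrib]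
  refine Finset.sum_congr rfl fun e _ => ?_
  by_cases a1 : e.1 ∈ X <;> by_cases a2 : e.2 ∈ X <;> simp [a1, a2]

/-- Augmenting a set of arcs along a residual chain. -/
theorem exists_augment {A F : Finset (α × α)} (hF : F ⊆ A) : ∀ (l : List α) (a y : α),
    (a :: l).Nodup → (a :: l).IsChain (fun b c => (b, c) ∈ A \ F ∨ (c, b) ∈ F) →
    (a :: l).getLast? = some y →
    ∃ F' ⊆ A, (∀ w, netOut F' w =
      netOut F w + (unitAt a w - unitAt y w)) ∧
      ∀ e : α × α, (e.1 ∉ a :: l ∨ e.2 ∉ a :: l) → (e ∈ F' ↔ e ∈ F)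
  | [], a, y, _, _, hl => by
    simp at hl; subst hl
    exact ⟨F, hF, by simp, by simp⟩
  | b :: l, a, y, hn, hc, hl => by
    rw [List.isChain_cons_cons] at hc
    obtain ⟨ha, hn'⟩ := List.nodup_cons.1 hn
    obtain ⟨F', hF', hnet, hag⟩ := exists_augment hF l b y hn' hc.2 (by simpa using hl)
    -- As `a` is not on the rest of the chain, `F'` still agrees with `F` on the arcs between `a`
    -- and `b`. Inserting `(a, b)` and erasing `(b, a)` change the net outflow equally.
    rcases hc.1 with h | h
    · have h1 : (a, b) ∉ F' := by
        rw [hag _ (.inl ha)]; exact (Finset.mem_sdiff.1 h).2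
      refine ⟨insert (a, b) F', ?_, fun w => ?_, fun e he => ?_⟩
      · exact Finset.insert_subset (Finset.mem_sdiff.1 h).1 hF'
      · rw [netOut_insert h1, hnet]; ring
      · rw [← hag e (by simp only [List.mem_cons] at he ⊢; tauto), Finset.mem_insert]
        refine or_iff_right ?_
        rintro rfl
        simp at he
    · have h1 : (b, a) ∈ F' := by rw [hag _ (.inr ha)]; exact h
      refine ⟨F'.erase (b, a), (Finset.erase_subset _ _).trans hF', fun w => ?_, fun e he => ?_⟩
      · rw [netOut_erase h1, hnet]; ring
      · rw [← hag e (by simp only [List.mem_cons] at he ⊢; tauto), Finset.mem_erase]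
        refine and_iff_right ?_
        rintro rfl
        simp at he

/-- Max-flow min-cut: if every cut has at least `m` arcs then there is a flow of value `m`. -/
theorem exists_isUnitFlow {A : Finset (α × α)} {x y : α} (m : ℕ)
    (h : ∀ X : Set α, x ∈ X → y ∉ X →
      m ≤ ({e ∈ (A : Set (α × α)) | e.1 ∈ X ∧ e.2 ∉ X}).ncard) :
    ∃ F, IsUnitFlow A x y F m := by
  induction m with
  | zero => exact ⟨∅, by simp, by simp [netOut]⟩
  | succ m ih =>
    obtain ⟨F, hF⟩ := ih fun X hx hy => (Nat.le_succ m).trans (h X hx hy)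
    by_cases hr : ReflTransGen (fun b c => (b, c) ∈ A \ F ∨ (c, b) ∈ F) x y
    · obtain ⟨l, hn, hc, hl⟩ := exists_nodup_chain_of_reflTransGen hr
      obtain ⟨F', hF', hnet, -⟩ := exists_augment hF.subset l x y hn hc hl
      refine ⟨F', hF', fun w => ?_⟩
      rw [hnet, hF.net]; push_cast; ring
    · exfalso
      -- No residual step leaves `X`: all arcs of `A` leaving it are used and no arc of `F` enters
      -- it, so the flow value `m` is the size of this cut.
      let X : Set α := {w | ReflTransGen (fun b c => (b, c) ∈ A \ F ∨ (c, b) ∈ F) x w}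
      have hx : x ∈ X := ReflTransGen.refl
      have hy : y ∉ X := hr
      have hv := hF.value_eq hx hy
      have e1 : {e ∈ (F : Set (α × α)) | e.1 ∈ X ∧ e.2 ∉ X} =
          {e ∈ (A : Set (α × α)) | e.1 ∈ X ∧ e.2 ∉ X} := by
        ext ⟨b, c⟩
        rw [Set.mem_sep_iff, Set.mem_sep_iff, Finset.mem_coe, Finset.mem_coe]
        refine ⟨fun h => ⟨hF.subset h.1, h.2⟩, fun h => ⟨?_, h.2⟩⟩
        by_contra hb
        exact h.2.2 (ReflTransGen.tail h.2.1 (.inl (Finset.mem_sdiff.2 ⟨h.1, hb⟩)))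
      have e2 : {e ∈ (F : Set (α × α)) | e.1 ∉ X ∧ e.2 ∈ X} = ∅ := by
        ext ⟨b, c⟩
        simp only [Finset.mem_coe, Set.mem_empty_iff_false, iff_false]
        rintro ⟨h1, h2, h3⟩
        exact h2 (ReflTransGen.tail h3 (.inr h1))
      rw [e1, e2, Set.ncard_empty] at hv
      have := h X hx hy
      omega

/-- Removing the arcs of a chain from a set of arcs. -/
theorem netOut_sdiff_pathArcs {F : Finset (α × α)} : ∀ (l : List α) (a y : α),
    (a :: l).Nodup → (a :: l).IsChain (fun b c => (b, c) ∈ F) → (a :: l).getLast? = some y →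
    ∀ w, netOut (F \ (FinDigraph.pathArcs (a :: l)).toFinset) w =
      netOut F w - (unitAt a w - unitAt y w)
  | [], a, y, _, _, hl, w => by
    simp at hl; subst hl; simp [FinDigraph.pathArcs]
  | b :: l, a, y, hn, hc, hl, w => by
    rw [List.isChain_cons_cons] at hc
    obtain ⟨ha, hn'⟩ := List.nodup_cons.1 hn
    have ih := netOut_sdiff_pathArcs l b y hn' hc.2 (by simpa using hl) w
    have hm : (a, b) ∈ F \ (FinDigraph.pathArcs (b :: l)).toFinset := by
      rw [Finset.mem_sdiff, List.mem_toFinset]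
      exact ⟨hc.1, fun h => ha (FinDigraph.mem_of_mem_pathArcs h).1⟩
    have he : F \ (FinDigraph.pathArcs (a :: b :: l)).toFinset =
        (F \ (FinDigraph.pathArcs (b :: l)).toFinset).erase (a, b) := by
      ext e
      simp only [FinDigraph.pathArcs_cons_cons, Finset.mem_sdiff, List.toFinset_cons,
        Finset.mem_insert, Finset.mem_erase]
      tauto
    have := netOut_erase hm w
    rw [he, this, ih]; ring

/-- A flow of positive value contains a path from `x` to `y`, since otherwise the set reachable from
`x` would have no outflow. Removing the path lowers the value by one, and the paths found later
avoid its arcs. -/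
theorem IsUnitFlow.exists_paths {A : Finset (α × α)} {x y : α} (m : ℕ) :
    ∀ F, IsUnitFlow A x y F m → ∃ P : Fin m → List α,
      (∀ i, (P i).head? = some x ∧ (P i).getLast? = some y ∧ (P i).Nodup ∧
        (P i).IsChain (fun b c => (b, c) ∈ F)) ∧
      ∀ i j, i ≠ j → (FinDigraph.pathArcs (P i)).Disjoint (FinDigraph.pathArcs (P j)) := by
  induction m with
  | zero => exact fun F _ => ⟨fun i => i.elim0, fun i => i.elim0, fun i => i.elim0⟩
  | succ m ih =>
    intro F hF
    have hr : ReflTransGen (fun b c => (b, c) ∈ F) x y := by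
      by_contra hr
      let X : Set α := {w | ReflTransGen (fun b c => (b, c) ∈ F) x w}
      have hv := hF.value_eq (X := X) .refl hr
      have e1 : {e ∈ (F : Set (α × α)) | e.1 ∈ X ∧ e.2 ∉ X} = ∅ := by
        ext ⟨b, c⟩
        simp only [Finset.mem_coe, Set.mem_empty_iff_false, iff_false]
        rintro ⟨h1, h2, h3⟩
        exact h3 (ReflTransGen.tail h2 h1)
      rw [e1, Set.ncard_empty] at hv
      omega
    obtain ⟨l, hn, hc, hl⟩ := exists_nodup_chain_of_reflTransGen hr
    have hG : IsUnitFlow A x y (F \ (FinDigraph.pathArcs (x :: l)).toFinset) m := by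
      refine ⟨Finset.sdiff_subset.trans hF.subset, fun w => ?_⟩
      have := netOut_sdiff_pathArcs l x y hn hc hl w
      rw [hF.net] at this
      push_cast at this
      rw [this]; ring
    obtain ⟨P, hP, hd⟩ := ih _ hG
    have hP' : ∀ i, (FinDigraph.pathArcs (x :: l)).Disjoint (FinDigraph.pathArcs (P i)) := by
      intro i e he he'
      have := FinDigraph.rel_of_mem_pathArcs (hP i).2.2.2 e he'
      simp only [Prod.mk.eta, Finset.mem_sdiff, List.mem_toFinset] at this
      exact this.2 he
    refine ⟨Fin.cons (x :: l) P, fun i => ?_, fun i j => ?_⟩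
    · refine Fin.cases ⟨rfl, hl, hn, hc⟩ (fun i => ?_) i
      simp only [Fin.cons_succ]
      exact ⟨(hP i).1, (hP i).2.1, (hP i).2.2.1, (hP i).2.2.2.imp fun a b h =>
        (Finset.mem_sdiff.1 h).1⟩
    · refine Fin.cases (Fin.cases (by simp) (fun j _ => ?_) j)
        (fun i => Fin.cases (fun _ => ?_) (fun j h => ?_) j) i
      · simpa using hP' j
      · simpa using (hP' i).symm
      · simpa using hd i j (by simpa using h)

/-- Menger's theorem for arc-disjoint dipaths. -/
theorem menger_arc {A : Set (α × α)} (hA : A.Finite) {x y : α} (m : ℕ)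
    (h : ∀ X : Set α, x ∈ X → y ∉ X → m ≤ ({e ∈ A | e.1 ∈ X ∧ e.2 ∉ X}).ncard) :
    ∃ P : Fin m → List α,
      (∀ i, (P i).head? = some x ∧ (P i).getLast? = some y ∧ (P i).Nodup ∧
        (P i).IsChain (fun b c => (b, c) ∈ A)) ∧
      ∀ i j, i ≠ j → (FinDigraph.pathArcs (P i)).Disjoint (FinDigraph.pathArcs (P j)) := by
  lift A to Finset (α × α) using hA
  obtain ⟨F, hF⟩ := exists_isUnitFlow m h
  obtain ⟨P, hP, hd⟩ := hF.exists_paths m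
  exact ⟨P, fun i => ⟨(hP i).1, (hP i).2.1, (hP i).2.2.1, (hP i).2.2.2.imp fun a b h =>
    hF.subset h⟩, hd⟩

end Menger

namespace FinDigraph

variable {α : Type*}

/-- The arcs leaving `X`. -/
def outArcs (D : FinDigraph α) (X : Set α) : Set (α × α) := {e ∈ D.arcs | e.1 ∈ X ∧ e.2 ∉ X}

theorem finite_arcs (D : FinDigraph α) : D.arcs.Finite :=
  (D.finite_verts.prod D.finite_verts).subset fun e he => D.arcs_subset e he

theorem finite_outArcs (D : FinDigraph α) (X : Set α) : (D.outArcs X).Finite :=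
  D.finite_arcs.subset fun _ he => he.1

/-! ### Local arc-connectivity and cuts -/

theorem HasArcDisjointDipaths.le_ncard {D : FinDigraph α} {x y : α} {m : ℕ}
    (h : D.HasArcDisjointDipaths x y m) {X : Set α} (hx : x ∈ X) (hy : y ∉ X) :
    m ≤ (D.outArcs X).ncard := by
  obtain ⟨P, hP, hd⟩ := h
  choose e he heX using fun i => exists_pathArcs_leaving (hP i).1 (hP i).2.1 hx hy
  have hinj : Function.Injective e := fun i j hij => by
    by_contra hne
    exact hd i j hne (he i) (hij ▸ he j)
  have hsub : Set.range e ⊆ D.outArcs X := by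
    rintro _ ⟨i, rfl⟩
    exact ⟨rel_of_mem_pathArcs (hP i).2.2.2.2 _ (he i), heX i⟩
  calc m = (Set.range e).ncard := by
        rw [← Set.image_univ, Set.ncard_image_of_injective _ hinj, Set.ncard_univ, Nat.card_fin]
    _ ≤ _ := Set.ncard_le_ncard hsub (D.finite_outArcs X)

theorem chain_subset_verts (D : FinDigraph α) : ∀ {p : List α} {x : α}, p.head? = some x →
    x ∈ D.verts → p.IsChain (fun a b => (a, b) ∈ D.arcs) → ∀ z ∈ p, z ∈ D.verts
  | [], x, h, _, _, z, hz => by simp at hz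
  | [a], x, h, hx, _, z, hz => by
    simp at h hz; subst h hz; exact hx
  | a :: b :: l, x, h, hx, hc, z, hz => by
    simp at h; subst h
    rw [List.isChain_cons_cons] at hc
    rcases List.mem_cons.1 hz with rfl | hz
    · exact hx
    · exact D.chain_subset_verts (p := b :: l) rfl (D.arcs_subset _ hc.1).2 hc.2 z hz

/-- The arc set `A` makes it possible to find the paths inside an induced subdigraph. -/
theorem hasArcDisjointDipaths_of_cuts (D : FinDigraph α) {x y : α} (hx : x ∈ D.verts) (m : ℕ)
    {A : Set (α × α)} (hA : A ⊆ D.arcs)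
    (h : ∀ X : Set α, x ∈ X → y ∉ X → m ≤ ({e ∈ A | e.1 ∈ X ∧ e.2 ∉ X}).ncard) :
    D.HasArcDisjointDipaths x y m := by
  obtain ⟨P, hP, hd⟩ := menger_arc (D.finite_arcs.subset hA) m h
  refine ⟨P, fun i => ?_, hd⟩
  have hc := (hP i).2.2.2.imp fun a b h => hA h
  exact ⟨(hP i).1, (hP i).2.1, (hP i).2.2.1, D.chain_subset_verts (hP i).1 hx hc, hc⟩

/-- The arcs leaving `{x}` bound the supremum; for an unbounded set of naturals `sSup` would be 0.
-/
theorem le_localArcConn (D : FinDigraph α) {x y : α} (hxy : x ≠ y) {m : ℕ}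
    (h : D.HasArcDisjointDipaths x y m) : m ≤ D.localArcConn x y :=
  le_csSup ⟨_, fun _ hm => HasArcDisjointDipaths.le_ncard hm (X := {x}) rfl (fun h => hxy h.symm)⟩ h

theorem localArcConn_le (D : FinDigraph α) {x y : α} {X : Set α} (hx : x ∈ X) (hy : y ∉ X) :
    D.localArcConn x y ≤ (D.outArcs X).ncard :=
  csSup_le' fun _ hm => HasArcDisjointDipaths.le_ncard hm hx hy

theorem localArcConn_le_maxLocalArcConn (D : FinDigraph α) {x y : α} (hx : x ∈ D.verts)
    (hy : y ∈ D.verts) (hxy : x ≠ y) : D.localArcConn x y ≤ D.maxLocalArcConn := by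
  refine le_csSup ⟨D.arcs.ncard, ?_⟩ ⟨x, hx, y, hy, hxy, rfl⟩
  rintro _ ⟨a, -, b, -, hab, rfl⟩
  exact (D.localArcConn_le (X := {a}) rfl (fun h => hab h.symm)).trans
    (Set.ncard_le_ncard (fun _ h => h.1) D.finite_arcs)

theorem le_maxLocalArcConn (D : FinDigraph α) {x y : α} (hx : x ∈ D.verts)
    (hy : y ∈ D.verts) (hxy : x ≠ y) {m : ℕ} (h : D.HasArcDisjointDipaths x y m) :
    m ≤ D.maxLocalArcConn :=
  (D.le_localArcConn hxy h).trans (D.localArcConn_le_maxLocalArcConn hx hy hxy)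

/-- Every ordered pair of distinct vertices is separated by a cut of at most `k` arcs. -/
def HasSmallCuts (D : FinDigraph α) (k : ℕ) : Prop :=
  ∀ x ∈ D.verts, ∀ y ∈ D.verts, x ≠ y → ∃ X : Set α, x ∈ X ∧ y ∉ X ∧ (D.outArcs X).ncard ≤ k

theorem maxLocalArcConn_le_iff (D : FinDigraph α) {k : ℕ} :
    D.maxLocalArcConn ≤ k ↔ D.HasSmallCuts k := by
  constructor
  · intro h x hx y hy hxy
    by_contra! hX
    have := D.le_maxLocalArcConn hx hy hxy
      (D.hasArcDisjointDipaths_of_cuts hx (k + 1) subset_rfl fun X h1 h2 => hX X h1 h2)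
    omega
  · intro h
    refine csSup_le' ?_
    rintro _ ⟨x, hx, y, hy, hxy, rfl⟩
    obtain ⟨X, h1, h2, h3⟩ := h x hx y hy hxy
    exact (D.localArcConn_le h1 h2).trans h3

/-! ### Strong connectivity -/

theorem IsStrong.reflTransGen {D : FinDigraph α} (h : D.IsStrong) {x y : α} (hx : x ∈ D.verts)
    (hy : y ∈ D.verts) : ReflTransGen (fun a b => (a, b) ∈ D.arcs) x y := by
  obtain ⟨p, h1, h2, -, -, h3⟩ := h x hx y hy
  exact reflTransGen_of_chain h1 h2 h3

theorem isStrong_of_outArcs_nonempty {D : FinDigraph α}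
    (h : ∀ X : Set α, (∃ x ∈ D.verts, x ∈ X) → (∃ y ∈ D.verts, y ∉ X) → (D.outArcs X).Nonempty) :
    D.IsStrong := by
  intro x hx y hy
  have hr : ReflTransGen (fun a b => (a, b) ∈ D.arcs) x y := by
    by_contra hr
    obtain ⟨⟨a, b⟩, hab, ha, hb⟩ := h {w | ReflTransGen (fun a b => (a, b) ∈ D.arcs) x w}
      ⟨x, hx, .refl⟩ ⟨y, hy, hr⟩
    exact hb (ReflTransGen.tail ha hab)
  obtain ⟨l, hn, hc, hl⟩ := exists_nodup_chain_of_reflTransGen hr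
  exact ⟨x :: l, rfl, hl, hn, D.chain_subset_verts rfl hx hc, hc⟩

/-! ### Connectivity of the underlying graph -/

/-- `a` and `b` are adjacent in the underlying graph. -/
def Adjacent (D : FinDigraph α) (a b : α) : Prop := (a, b) ∈ D.arcs ∨ (b, a) ∈ D.arcs

theorem Adjacent.symm {D : FinDigraph α} {a b : α} (h : D.Adjacent a b) : D.Adjacent b a :=
  Or.symm h

theorem Adjacent.mem {D : FinDigraph α} {a b : α} (h : D.Adjacent a b) :
    a ∈ D.verts ∧ b ∈ D.verts := by
  rcases h with h | h
  · exact D.arcs_subset _ h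
  · exact (D.arcs_subset _ h).symm

theorem Adjacent.ne {D : FinDigraph α} {a b : α} (h : D.Adjacent a b) : a ≠ b := by
  rcases h with h | h
  · exact D.loopless _ h
  · exact (D.loopless _ h).symm

/-- `S` is a nonempty union of components of the underlying graph of `D - z`. -/
structure IsClosedAvoiding (D : FinDigraph α) (z : α) (S : Set α) : Prop where
  subset : S ⊆ D.verts
  nonempty : S.Nonempty
  notMem : z ∉ S
  closed : ∀ a ∈ S, ∀ b, b ≠ z → D.Adjacent a b → b ∈ S

theorem underlying_adj (D : FinDigraph α) (a b : D.verts) :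
    D.underlying.Adj a b ↔ D.Adjacent a b := by
  rw [underlying, SimpleGraph.fromRel_adj]
  exact and_iff_right_of_imp fun h e => Adjacent.ne h (congrArg Subtype.val e)

/-- With `isBiconnected_of_isStrong` this replaces walks in the underlying graph by closed vertex
sets. -/
theorem IsBiconnected.eq_of_isClosedAvoiding {D : FinDigraph α} (h : D.IsBiconnected) {z : α}
    (hz : z ∈ D.verts) {S : Set α} (hS : D.IsClosedAvoiding z S) {b : α} (hb : b ∈ D.verts)
    (hbz : b ≠ z) : b ∈ S := by
  obtain ⟨a, ha⟩ := hS.nonempty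
  have haz : a ≠ z := fun e => hS.notMem (e ▸ ha)
  let v : D.verts := ⟨z, hz⟩
  have hr := h.2 v ⟨⟨a, hS.subset ha⟩, fun e => haz (congrArg Subtype.val e)⟩
    ⟨⟨b, hb⟩, fun e => hbz (congrArg Subtype.val e)⟩
  have key : ∀ p q, (D.underlying.induce {v}ᶜ).Reachable p q → (p : D.verts).1 ∈ S →
      (q : D.verts).1 ∈ S := by
    rintro p q ⟨w⟩
    induction w with
    | nil => exact id
    | cons hadj _ ih =>
      intro hp
      rename_i a' b' c' _
      refine ih (hS.closed _ hp _ (fun e => b'.2 (Subtype.ext e)) ?_)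
      exact (D.underlying_adj _ _).1 hadj
  exact key _ _ hr ha

theorem isBiconnected_of_isStrong {D : FinDigraph α} (hD : D.IsStrong) (hne : D.verts.Nonempty)
    (h : ∀ z ∈ D.verts, ∀ S, D.IsClosedAvoiding z S → ∀ b ∈ D.verts, b ≠ z → b ∈ S) :
    D.IsBiconnected := by
  constructor
  · have : Nonempty D.verts := hne.to_subtype
    refine ⟨fun x y => ?_⟩
    have hr := hD.reflTransGen x.2 y.2
    have key : ∀ b : α, ReflTransGen (fun a b => (a, b) ∈ D.arcs) x.1 b →
        ∃ hb : b ∈ D.verts, D.underlying.Reachable x ⟨b, hb⟩ := by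
      intro b hb
      induction hb with
      | refl => exact ⟨x.2, .refl _⟩
      | tail _ hbc ih =>
        obtain ⟨hb, hr⟩ := ih
        exact ⟨(D.arcs_subset _ hbc).2, hr.trans
          (SimpleGraph.Adj.reachable ((D.underlying_adj _ _).2 (.inl hbc)))⟩
    exact (key _ hr).2
  · intro z x y
    let S : Set α := {w | ∃ (hw : w ∈ D.verts) (hz : (⟨w, hw⟩ : D.verts) ∈ ({z}ᶜ : Set D.verts)),
      (D.underlying.induce {z}ᶜ).Reachable x ⟨⟨w, hw⟩, hz⟩}
    have hS : D.IsClosedAvoiding z S := by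
      refine ⟨fun w hw => hw.1, ⟨x.1.1, x.1.2, x.2, .refl _⟩, fun hz => hz.2.1 rfl, ?_⟩
      rintro a ⟨ha, haz, hr⟩ b hb hab
      refine ⟨hab.mem.2, fun e => hb (congrArg Subtype.val e), hr.trans ?_⟩
      exact SimpleGraph.Adj.reachable ((D.underlying_adj _ _).2 hab)
    obtain ⟨_, _, hr⟩ := h z z.2 S hS y.1.1 y.1.2 fun e => y.2 (Subtype.ext e)
    exact hr

/-! ### Colourings -/

end FinDigraph

/-- The relation `r` has no closed walk. -/
def AcyclicRel {α : Type*} (r : α → α → Prop) : Prop := ∀ a, ¬ TransGen r a a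

namespace FinDigraph

variable {α : Type*}

/-- The monochromatic arcs inside `W`. -/
def MonoArc (D : FinDigraph α) (W : Set α) {k : ℕ} (φ : α → Fin k) (a b : α) : Prop :=
  (a, b) ∈ D.arcs ∧ a ∈ W ∧ b ∈ W ∧ φ a = φ b

/-- The subdigraph induced by `W` has a `k`-dicolouring. -/
def Colourable (D : FinDigraph α) (W : Set α) (k : ℕ) : Prop :=
  ∃ φ : α → Fin k, AcyclicRel (D.MonoArc W φ)

theorem mem_of_isChain_cons {r : α → α → Prop} : ∀ {l : List α} {a z : α}, (a :: l).IsChain r →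
    z ∈ a :: l → ReflTransGen r a z
  | [], a, z, _, hz => by simp at hz; subst hz; exact .refl
  | b :: l, a, z, hc, hz => by
    rw [List.isChain_cons_cons] at hc
    rcases List.mem_cons.1 hz with rfl | hz
    · exact .refl
    · exact .head hc.1 (mem_of_isChain_cons hc.2 hz)

theorem Colourable.exists_isDicolouring {D : FinDigraph α} {k : ℕ} (h : D.Colourable D.verts k) :
    ∃ φ : D.verts → Fin k, D.IsDicolouring φ := by
  obtain ⟨φ, hφ⟩ := h
  refine ⟨fun z => φ z, ?_⟩
  rintro i ⟨c, ⟨x, y, ⟨h1, h2, -, hv, hc⟩, hyx⟩, hcol⟩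
  have hc' : c.IsChain (D.MonoArc D.verts φ) := hc.imp_of_mem_imp fun a b ha hb hab =>
    ⟨hab, hv a ha, hv b hb, (hcol a (hv a ha) ha).trans (hcol b (hv b hb) hb).symm⟩
  have hx : x ∈ c := List.mem_of_mem_head? h1
  have hy : y ∈ c := List.mem_of_getLast? h2
  exact hφ x (TransGen.tail' (reflTransGen_of_chain h1 h2 hc')
    ⟨hyx, hv y hy, hv x hx, (hcol y (hv y hy) hy).trans (hcol x (hv x hx) hx).symm⟩)

theorem colourable_of_isDicolouring {D : FinDigraph α} {m k : ℕ} (hk : 0 < k) (hm : m ≤ k)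
    {φ : D.verts → Fin m} (h : D.IsDicolouring φ) : D.Colourable D.verts k := by
  classical
  -- Vertices outside `D` get the colour 0, which exists because `k` is positive.
  let ψ : α → Fin k := fun a => if ha : a ∈ D.verts then Fin.castLE hm (φ ⟨a, ha⟩) else ⟨0, hk⟩
  refine ⟨ψ, fun a ha => ?_⟩
  -- The closed walk is shortened to a chain without repetitions from `a` to `b`, which the last
  -- step closes to a directed cycle.
  obtain ⟨b, hab, hba⟩ := TransGen.tail'_iff.1 ha
  obtain ⟨l, hn, hc, hl⟩ := exists_nodup_chain_of_reflTransGen hab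
  have haV : a ∈ D.verts := hba.2.2.1
  have hc' : (a :: l).IsChain (fun a b => (a, b) ∈ D.arcs) := hc.imp fun _ _ h => h.1
  refine h (φ ⟨a, haV⟩) ⟨a :: l, ⟨a, b, ⟨rfl, hl, hn, D.chain_subset_verts rfl haV hc', hc'⟩,
    hba.1⟩, fun z hz hzl => ?_⟩
  have hψ : ψ a = ψ z := by
    have := mem_of_isChain_cons hc hzl
    clear * - this
    induction this with
    | refl => rfl
    | tail _ h ih => exact ih.trans h.2.2.2
  simp only [ψ, haV, hz, dif_pos] at hψ
  exact (Fin.castLE_injective hm hψ).symm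

theorem dichromaticNumber_eq_of_colourable {D : FinDigraph α} {k : ℕ} (hk : 0 < k)
    (h : D.Colourable D.verts (k + 1)) (h' : ¬ D.Colourable D.verts k) :
    D.dichromaticNumber = k + 1 := by
  refine le_antisymm (Nat.sInf_le h.exists_isDicolouring) ?_
  refine le_csInf ⟨_, h.exists_isDicolouring⟩ ?_
  rintro m ⟨φ, hφ⟩
  by_contra! hm
  exact h' (colourable_of_isDicolouring hk (Nat.lt_succ_iff.1 hm) hφ)

theorem not_colourable_of_lt_dichromaticNumber {D : FinDigraph α} {k : ℕ}
    (h : k < D.dichromaticNumber) : ¬ D.Colourable D.verts k := fun hc =>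
  absurd (Nat.sInf_le hc.exists_isDicolouring) (not_le.2 h)

end FinDigraph

/-! ### Criteria for acyclicity. -/

theorem AcyclicRel.mono {α : Type*} {r s : α → α → Prop} (hs : AcyclicRel s)
    (h : ∀ a b, r a b → s a b) : AcyclicRel r :=
  fun a ha => hs a (TransGen.mono h _ _ ha)

/-- If the steps of `r` either stay in a fibre of `ρ` or project to steps of an acyclic relation,
and `r` is acyclic on fibres, then `r` is acyclic. -/
theorem AcyclicRel.of_fibres {α β : Type*} {r : α → α → Prop} {s : β → β → Prop} (ρ : α → β)
    (hs : AcyclicRel s) (hr : ∀ a b, r a b → ρ a = ρ b ∨ s (ρ a) (ρ b))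
    (hfib : AcyclicRel fun a b => r a b ∧ ρ a = ρ b) : AcyclicRel r := by
  have key : ∀ a b, TransGen r a b → TransGen s (ρ a) (ρ b) ∨
      (ρ a = ρ b ∧ TransGen (fun a b => r a b ∧ ρ a = ρ b) a b) := by
    intro a b hab
    induction hab with
    | single h =>
      rcases hr _ _ h with e | e
      · exact .inr ⟨e, .single ⟨h, e⟩⟩
      · exact .inl (.single e)
    | tail _ h ih =>
      rcases hr _ _ h with e | e
      · rcases ih with i | ⟨i, i'⟩
        · exact .inl (e ▸ i)
        · exact .inr ⟨i.trans e, i'.tail ⟨h, e⟩⟩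
      · rcases ih with i | ⟨i, -⟩
        · exact .inl (i.tail e)
        · exact .inl (.single (i ▸ e))
  intro a ha
  rcases key a a ha with h | ⟨-, h⟩
  · exact hs _ h
  · exact hfib _ h

/-- A closed walk that enters `X` never leaves it, hence lies entirely inside or entirely outside.
-/
theorem AcyclicRel.of_closed {α : Type*} {r : α → α → Prop} {X : Set α}
    (hX : ∀ a b, r a b → a ∈ X → b ∈ X) (h1 : AcyclicRel fun a b => r a b ∧ a ∈ X ∧ b ∈ X)
    (h2 : AcyclicRel fun a b => r a b ∧ a ∉ X ∧ b ∉ X) : AcyclicRel r := by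
  have hs : AcyclicRel fun p q : Prop => ¬ p ∧ q := by
    intro p hp
    obtain ⟨q, h, -⟩ := TransGen.head'_iff.1 hp
    obtain ⟨q', -, h'⟩ := TransGen.tail'_iff.1 hp
    exact h.1 h'.2
  have hfib : AcyclicRel fun a b => (r a b ∧ (a ∈ X) = (b ∈ X)) := by
    refine AcyclicRel.of_fibres (s := fun p q : Prop => ¬ p ∧ q) (· ∈ X) hs
      (fun a b h => .inl h.2) fun a ha => ?_
    by_cases haX : a ∈ X
    · have key : ∀ b, TransGen (fun a b => (r a b ∧ (a ∈ X) = (b ∈ X)) ∧ (a ∈ X) = (b ∈ X)) a b →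
          TransGen (fun a b => r a b ∧ a ∈ X ∧ b ∈ X) a b ∧ b ∈ X := by
        intro b hb
        induction hb with
        | single h => exact ⟨.single ⟨h.1.1, haX, h.2 ▸ haX⟩, h.2 ▸ haX⟩
        | tail _ h ih => exact ⟨ih.1.tail ⟨h.1.1, ih.2, h.2 ▸ ih.2⟩, h.2 ▸ ih.2⟩
      exact h1 _ (key a ha).1
    · have key : ∀ b, TransGen (fun a b => (r a b ∧ (a ∈ X) = (b ∈ X)) ∧ (a ∈ X) = (b ∈ X)) a b →
          TransGen (fun a b => r a b ∧ a ∉ X ∧ b ∉ X) a b ∧ b ∉ X := by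
        intro b hb
        induction hb with
        | single h => exact ⟨.single ⟨h.1.1, haX, h.2 ▸ haX⟩, h.2 ▸ haX⟩
        | tail _ h ih => exact ⟨ih.1.tail ⟨h.1.1, ih.2, h.2 ▸ ih.2⟩, h.2 ▸ ih.2⟩
      exact h2 _ (key a ha).1
  refine AcyclicRel.of_fibres (· ∈ X) hs (fun a b h => ?_) hfib
  by_cases ha : a ∈ X
  · exact .inl (by simp [ha, hX a b h ha])
  · by_cases hb : b ∈ X
    · exact .inr ⟨ha, hb⟩
    · exact .inl (by simp [ha, hb])

/-- Adding the pair `(v, u)` to an acyclic relation in which `v` is not reachable from `u`. -/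
theorem AcyclicRel.add_pair {α : Type*} {r : α → α → Prop} (h : AcyclicRel r) {u v : α}
    (huv : ¬ ReflTransGen r u v) : AcyclicRel fun a b => r a b ∨ (a = v ∧ b = u) := by
  have key : ∀ a b, TransGen (fun a b => r a b ∨ (a = v ∧ b = u)) a b →
      TransGen r a b ∨ (ReflTransGen r a v ∧ ReflTransGen r u b) := by
    intro a b hab
    induction hab with
    | single h =>
      rcases h with h | ⟨rfl, rfl⟩
      · exact .inl (.single h)
      · exact .inr ⟨.refl, .refl⟩
    | tail _ h ih =>
      rcases h with h | ⟨rfl, rfl⟩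
      · rcases ih with i | ⟨i, i'⟩
        · exact .inl (i.tail h)
        · exact .inr ⟨i, i'.tail h⟩
      · rcases ih with i | ⟨i, -⟩
        · exact .inr ⟨i.to_reflTransGen, .refl⟩
        · exact .inr ⟨i, .refl⟩
  intro a ha
  rcases key a a ha with i | ⟨i, i'⟩
  · exact h a i
  · exact huv (i'.trans i)

/-! ### Critical vertex sets and extremal digraphs. -/

namespace FinDigraph

variable {α : Type*}

/-- Two colourings can be combined if there are few arcs from one part to the other. -/
theorem Colourable.of_few_arcs {D : FinDigraph α} {W X : Set α} {k : ℕ}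
    (h1 : D.Colourable (W ∩ X) k) (h2 : D.Colourable (W \ X) k)
    (h : {e ∈ D.arcs | (e.1 ∈ W ∧ e.2 ∈ W) ∧ e.1 ∈ X ∧ e.2 ∉ X}.ncard < k) :
    D.Colourable W k := by
  classical
  have : NeZero k := ⟨by omega⟩
  obtain ⟨φ, hφ⟩ := h1
  obtain ⟨ψ, hψ⟩ := h2
  set B := {e ∈ D.arcs | (e.1 ∈ W ∧ e.2 ∈ W) ∧ e.1 ∈ X ∧ e.2 ∉ X} with hB
  have hfin : B.Finite := D.finite_arcs.subset fun _ he => he.1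
  -- The second colouring is shifted cyclically. Each arc from `X` to the rest spoils at most one
  -- shift, so fewer than `k` arcs leave a shift with no monochromatic arc out of `X`.
  obtain ⟨c, hc⟩ : ∃ c : Fin k, c ∉ (fun e => φ e.1 - ψ e.2) '' B := by
    by_contra! hc
    have h3 := Set.ncard_image_le (f := fun e => φ e.1 - ψ e.2) hfin
    rw [Set.eq_univ_of_forall hc, Set.ncard_univ, Nat.card_fin] at h3
    omega
  refine ⟨fun a => if a ∈ X then φ a else ψ a + c, ?_⟩
  refine AcyclicRel.of_closed (X := X) ?_ (hφ.mono ?_) (hψ.mono ?_)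
  · rintro a b ⟨hab, ha, hb, e⟩ haX
    by_contra hbX
    simp only [haX, hbX, if_true, if_false] at e
    exact hc ⟨(a, b), ⟨hab, ⟨ha, hb⟩, haX, hbX⟩, by simp [e]⟩
  · rintro a b ⟨⟨hab, ha, hb, e⟩, haX, hbX⟩
    simp only [haX, hbX, if_true] at e
    exact ⟨hab, ⟨ha, haX⟩, ⟨hb, hbX⟩, e⟩
  · rintro a b ⟨⟨hab, ha, hb, e⟩, haX, hbX⟩
    simp only [haX, hbX, if_false] at e
    exact ⟨hab, ⟨ha, haX⟩, ⟨hb, hbX⟩, add_right_cancel e⟩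

/-- `W` is minimal such that the subdigraph induced by `W` is not `k`-colourable. -/
structure IsCritical (D : FinDigraph α) (W : Set α) (k : ℕ) : Prop where
  not_colourable : ¬ D.Colourable W k
  colourable : ∀ W', W' ⊂ W → D.Colourable W' k

theorem exists_isCritical {D : FinDigraph α} {k : ℕ} (h : ¬ D.Colourable D.verts k) :
    ∃ W ⊆ D.verts, D.IsCritical W k := by
  obtain ⟨W, hW⟩ := Set.Finite.exists_minimal (s := {W | W ⊆ D.verts ∧ ¬ D.Colourable W k})
    (D.finite_verts.finite_subsets.subset fun _ h => h.1) ⟨_, subset_rfl, h⟩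
  refine ⟨W, hW.prop.1, hW.prop.2, fun W' hW' => ?_⟩
  by_contra hc
  exact hW'.2 (hW.le_of_le ⟨hW'.1.trans hW.prop.1, hc⟩ hW'.1)

theorem IsCritical.le_ncard_cut {D : FinDigraph α} {W : Set α} {k : ℕ} (hW : D.IsCritical W k)
    {X : Set α} {x y : α} (hx : x ∈ W) (hxX : x ∈ X) (hy : y ∈ W) (hyX : y ∉ X) :
    k ≤ {e ∈ D.arcs | (e.1 ∈ W ∧ e.2 ∈ W) ∧ e.1 ∈ X ∧ e.2 ∉ X}.ncard := by
  by_contra! h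
  refine hW.not_colourable (Colourable.of_few_arcs (hW.colourable _ ?_) (hW.colourable _ ?_) h)
  · exact ⟨Set.inter_subset_left, fun h => hyX (h hy).2⟩
  · exact ⟨Set.sdiff_subset, fun h => (h hx).2 hxX⟩

theorem IsCritical.nontrivial {D : FinDigraph α} {W : Set α} {k : ℕ} (hk : 0 < k)
    (hW : D.IsCritical W k) : W.Nontrivial := by
  by_contra h
  rw [Set.not_nontrivial_iff] at h
  refine hW.not_colourable ⟨fun _ => ⟨0, hk⟩, fun a ha => ?_⟩
  obtain ⟨b, hab, -⟩ := TransGen.head'_iff.1 ha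
  exact D.loopless _ hab.1 (h hab.2.1 hab.2.2.1)

/-- The bound χ ≤ λ + 1: the cuts inside a critical set are large, so Menger's theorem applies
there. -/
theorem le_maxLocalArcConn_of_not_colourable {D : FinDigraph α} {k : ℕ} (hk : 0 < k)
    (h : ¬ D.Colourable D.verts k) : k ≤ D.maxLocalArcConn := by
  obtain ⟨W, hWV, hW⟩ := exists_isCritical h
  obtain ⟨x, hx, y, hy, hxy⟩ := hW.nontrivial hk
  refine D.le_maxLocalArcConn (hWV hx) (hWV hy) hxy (D.hasArcDisjointDipaths_of_cuts (hWV hx) k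
    (A := {e ∈ D.arcs | e.1 ∈ W ∧ e.2 ∈ W}) (fun _ h => h.1) fun X hxX hyX => ?_)
  convert hW.le_ncard_cut hx hxX hy hyX using 2
  ext e
  simp only [Set.mem_ofPred_eq]
  tauto

theorem isExtremal_iff {D : FinDigraph α} {k : ℕ} (hk : 0 < k) :
    D.IsExtremal k ↔
      D.IsBiconnected ∧ D.IsStrong ∧ ¬ D.Colourable D.verts k ∧ D.HasSmallCuts k := by
  constructor
  · rintro ⟨h1, h2, h3, h4⟩
    refine ⟨h1, h2, not_colourable_of_lt_dichromaticNumber (by omega),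
      D.maxLocalArcConn_le_iff.1 (by omega)⟩
  · rintro ⟨h1, h2, h3, h4⟩
    have h5 := le_maxLocalArcConn_of_not_colourable hk h3
    have h6 := D.maxLocalArcConn_le_iff.2 h4
    have h7 : D.Colourable D.verts (k + 1) := by
      by_contra h
      have := le_maxLocalArcConn_of_not_colourable (Nat.succ_pos k) h
      omega
    have h8 := dichromaticNumber_eq_of_colourable hk h7 h3
    exact ⟨h1, h2, by omega, by omega⟩

/-- A biconnected strong digraph has an open ear on every proper subset with two vertices. -/
theorem exists_ear {D : FinDigraph α} (hs : D.IsStrong) (hb : D.IsBiconnected) {W : Set α}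
    (hWV : W ⊆ D.verts) (hW : W.Nontrivial) {z : α} (hz : z ∈ D.verts) (hzW : z ∉ W) :
    ∃ x ∈ W, ∃ y ∈ W, x ≠ y ∧
      TransGen (fun a b => (a, b) ∈ D.arcs ∧ ¬ (a ∈ W ∧ b ∈ W)) x y := by
  by_contra hno
  obtain ⟨w, hw⟩ := hW.nonempty
  set r : α → α → Prop := fun a b => (a, b) ∈ D.arcs ∧ ¬ (a ∈ W ∧ b ∈ W) with hr
  have hin : ∀ c, c ∈ D.verts → c ∉ W → ∃ x ∈ W, TransGen r x c := by
    intro c hc hcW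
    have h := hs.reflTransGen (hWV hw) hc
    have : c ∈ W ∨ ∃ x ∈ W, TransGen r x c := by
      clear hc hcW
      induction h with
      | refl => exact .inl hw
      | @tail b c _ hbc ih =>
        by_cases hcW : c ∈ W
        · exact .inl hcW
        · by_cases hbW : b ∈ W
          · exact .inr ⟨b, hbW, .single ⟨hbc, fun h => hcW h.2⟩⟩
          · obtain ⟨x, hx, h⟩ := ih.resolve_left hbW
            exact .inr ⟨x, hx, h.tail ⟨hbc, fun h => hcW h.2⟩⟩
    exact this.resolve_left hcW
  have hout : ∀ c, c ∈ D.verts → c ∉ W → ∃ x ∈ W, TransGen r c x := by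
    intro c hc hcW
    have h := hs.reflTransGen hc (hWV hw)
    have : c ∈ W ∨ ∃ x ∈ W, TransGen r c x := by
      clear hc hcW
      induction h using ReflTransGen.head_induction_on with
      | refl => exact .inl hw
      | @head c b hcb _ ih =>
        by_cases hcW : c ∈ W
        · exact .inl hcW
        · by_cases hbW : b ∈ W
          · exact .inr ⟨b, hbW, .single ⟨hcb, fun h => hcW h.1⟩⟩
          · obtain ⟨x, hx, h⟩ := ih.resolve_left hbW
            exact .inr ⟨x, hx, h.head ⟨hcb, fun h => hcW h.1⟩⟩
    exact this.resolve_left hcW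
  -- Without an ear, every excursion from `W` returns to the vertex it started from.
  have huniq : ∀ x ∈ W, ∀ y ∈ W, TransGen r x y → x = y := fun x hx y hy h => by
    by_contra hxy
    exact hno ⟨x, hx, y, hy, hxy, h⟩
  obtain ⟨h, hh, hhz⟩ := hin z hz hzW
  -- So `h` is a cutvertex: it separates the excursions starting at `h`, among them `z`, from the
  -- rest of `W`.
  have hS : D.IsClosedAvoiding h {c | c ∈ D.verts ∧ c ∉ W ∧ TransGen r h c} := by
    refine ⟨fun c hc => hc.1, ⟨z, hz, hzW, hhz⟩, fun hc => hc.2.1 hh, ?_⟩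
    rintro c ⟨hc, hcW, hhc⟩ b hbh hcb
    obtain ⟨y, hy, hcy⟩ := hout c hc hcW
    have hhy := huniq h hh y hy (hhc.trans hcy)
    have hb := hcb.mem.2
    by_cases hbW : b ∈ W
    · exfalso
      rcases hcb with hcb | hbc
      · exact hbh (huniq h hh b hbW (hhc.tail ⟨hcb, fun h => hcW h.1⟩)).symm
      · have : TransGen r b y := TransGen.head ⟨hbc, fun h => hcW h.2⟩ hcy
        exact hbh ((huniq b hbW y hy this).trans hhy.symm)
    · refine ⟨hb, hbW, ?_⟩
      rcases hcb with hcb | hbc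
      · exact hhc.tail ⟨hcb, fun h => hcW h.1⟩
      · obtain ⟨x, hx, hxb⟩ := hin b hb hbW
        have : TransGen r x y := (hxb.tail ⟨hbc, fun h => hcW h.2⟩).trans hcy
        rw [hhy, ← huniq x hx y hy this]
        exact hxb
  obtain ⟨w', hw', hne⟩ := hW.exists_ne h
  exact (hb.eq_of_isClosedAvoiding (hWV hh) hS (hWV hw') hne).2.1 hw'

/-- The vertex set of an extremal digraph is critical. -/
theorem IsExtremal.isCritical {D : FinDigraph α} {k : ℕ} (hk : 0 < k) (h : D.IsExtremal k) :
    D.IsCritical D.verts k := by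
  obtain ⟨hb, hs, hc, hcut⟩ := (isExtremal_iff hk).1 h
  obtain ⟨W, hWV, hW⟩ := exists_isCritical hc
  suffices hVW : D.verts ⊆ W by rwa [hWV.antisymm hVW] at hW
  intro z hz
  by_contra hzW
  obtain ⟨x, hx, y, hy, hxy, hear⟩ := exists_ear hs hb hWV (hW.nontrivial hk) hz hzW
  obtain ⟨X, hxX, hyX, hX⟩ := hcut x (hWV hx) y (hWV hy) hxy
  -- At least `k` arcs of the cut lie inside `W`, and the ear adds one that does not.
  have h1 := hW.le_ncard_cut hx hxX hy hyX
  obtain ⟨a, b, ⟨hab, habW⟩, haX, hbX⟩ : ∃ a b, ((a, b) ∈ D.arcs ∧ ¬ (a ∈ W ∧ b ∈ W)) ∧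
      a ∈ X ∧ b ∉ X := by
    clear * - hear hxX hyX
    induction hear with
    | single h => exact ⟨_, _, h, hxX, hyX⟩
    | @tail b c _ hbc ih =>
      by_cases hbX : b ∈ X
      · exact ⟨b, c, hbc, hbX, hyX⟩
      · exact ih hbX
  have h2 : {e ∈ D.arcs | (e.1 ∈ W ∧ e.2 ∈ W) ∧ e.1 ∈ X ∧ e.2 ∉ X} ⊂ D.outArcs X :=
    ⟨fun e he => ⟨he.1, he.2.2⟩, fun hsub =>
      habW (hsub (⟨hab, haX, hbX⟩ : (a, b) ∈ D.outArcs X)).2.1⟩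
  have h3 := Set.ncard_lt_ncard h2 (D.finite_outArcs X)
  omega

theorem IsExtremal.le_ncard_outArcs {D : FinDigraph α} {k : ℕ} (hk : 0 < k) (h : D.IsExtremal k)
    {X : Set α} (hX : ∃ x ∈ D.verts, x ∈ X) (hX' : ∃ y ∈ D.verts, y ∉ X) :
    k ≤ (D.outArcs X).ncard := by
  obtain ⟨x, hx, hxX⟩ := hX
  obtain ⟨y, hy, hyX⟩ := hX'
  exact ((h.isCritical hk).le_ncard_cut hx hxX hy hyX).trans
    (Set.ncard_le_ncard (fun e he => ⟨he.1, he.2.2⟩) (D.finite_outArcs X))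

end FinDigraph

/-! ### The two sides of a tree edge. -/

namespace SimpleGraph

variable {V : Type*} {T : SimpleGraph V}

theorem IsTree.not_reachable_deleteEdges (hT : T.IsTree) {u v : V} (h : T.Adj u v) :
    ¬ (T.deleteEdges {s(u, v)}).Reachable u v :=
  isAcyclic_iff_forall_adj_isBridge.1 hT.isAcyclic h

theorem reachable_deleteEdges_of_adj {u v s t : V} (hst : T.Adj s t) (hne : s(s, t) ≠ s(u, v))
    {x : V} (h : (T.deleteEdges {s(u, v)}).Reachable x s) :
    (T.deleteEdges {s(u, v)}).Reachable x t :=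
  h.trans (Adj.reachable (by rw [deleteEdges_adj]; exact ⟨hst, hne⟩))

theorem Connected.reachable_deleteEdges_or (hT : T.Connected) (u v t : V) :
    (T.deleteEdges {s(u, v)}).Reachable u t ∨ (T.deleteEdges {s(u, v)}).Reachable v t := by
  obtain ⟨p⟩ := hT.preconnected u t
  have key : ∀ a b (_ : T.Walk a b), ((T.deleteEdges {s(u, v)}).Reachable u a ∨
      (T.deleteEdges {s(u, v)}).Reachable v a) →
      ((T.deleteEdges {s(u, v)}).Reachable u b ∨ (T.deleteEdges {s(u, v)}).Reachable v b) := by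
    intro a b p
    induction p with
    | nil => exact id
    | @cons a c b hac _ ih =>
      intro h
      refine ih ?_
      by_cases he : s(a, c) = s(u, v)
      · rcases Sym2.eq_iff.1 he with ⟨-, rfl⟩ | ⟨-, rfl⟩
        · exact .inr (.refl _)
        · exact .inl (.refl _)
      · exact h.imp (reachable_deleteEdges_of_adj hac he) (reachable_deleteEdges_of_adj hac he)
  exact key u t p (.inl (.refl _))

/-- On each side of an edge of a finite tree there is a leaf of the tree. -/
theorem IsTree.exists_isLeafVertex_reachable [Finite V] (hT : T.IsTree) {u v : V}
    (huv : T.Adj u v) :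
    ∃ t, T.IsLeafVertex t ∧ (T.deleteEdges {s(u, v)}).Reachable v t := by
  have := Fintype.ofFinite V
  by_contra! hno
  have hreach : ∀ t (q : T.Walk v t), u ∉ q.support →
      (T.deleteEdges {s(u, v)}).Reachable v t := fun t q hq =>
    reachable_deleteEdges_iff_exists_walk.2 ⟨q, fun h => hq (q.fst_mem_support_of_mem_edges h)⟩
  -- Without a leaf on this side, a path starting with `u`, `v` extends forever: its end has a
  -- neighbour besides the penultimate vertex, and acyclicity keeps that neighbour off the path.
  have key : ∀ n : ℕ, ∃ t, ∃ q : T.Walk v t, q.IsPath ∧ u ∉ q.support ∧ q.length = n := by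
    intro n
    induction n with
    | zero => exact ⟨v, .nil, .nil, by simpa using huv.ne, rfl⟩
    | succ n ih =>
      obtain ⟨t, q, hq, hu, hn⟩ := ih
      have hp : (Walk.cons huv q).IsPath := (Walk.cons_isPath_iff huv q).2 ⟨hq, hu⟩
      have hleaf : ¬ T.IsLeafVertex t := fun h => hno t h (hreach t q hu)
      obtain ⟨w, hw, hne⟩ : ∃ w, T.Adj t w ∧ w ≠ (Walk.cons huv q).penultimate := by
        by_contra! hall
        exact hleaf ⟨_, (Walk.adj_penultimate Walk.not_nil_cons).symm, hall⟩
      have hws : w ∉ (Walk.cons huv q).support := fun h =>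
        hne (hT.isAcyclic.eq_penultimate_of_adj_end hp hw h)
      rw [Walk.support_cons, List.mem_cons, not_or] at hws
      refine ⟨w, q.concat hw, hq.concat hws.2 hw, ?_, by simp [hn]⟩
      rw [Walk.support_concat, List.mem_append, List.mem_singleton, not_or]
      exact ⟨hu, fun h => hws.1 h.symm⟩
  obtain ⟨t, q, hq, -, hn⟩ := key (Fintype.card V)
  exact absurd hq.length_lt (by omega)

/-- Two distinct vertices of a connected graph are separated, as far as a path shows, by the first
edge of the path. -/
theorem Connected.exists_adj_reachable (hT : T.Connected) {x y : V} (hxy : x ≠ y) :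
    ∃ w, T.Adj x w ∧ (T.deleteEdges {s(x, w)}).Reachable w y := by
  obtain ⟨p, hp⟩ := hT.exists_isPath x y
  cases p with
  | nil => exact absurd rfl hxy
  | @cons _ w _ h q =>
    refine ⟨w, h, reachable_deleteEdges_iff_exists_walk.2 ⟨q, fun he => ?_⟩⟩
    exact ((Walk.cons_isPath_iff h q).1 hp).2 (q.fst_mem_support_of_mem_edges he)

end SimpleGraph

/-! ### The face walk crosses each edge once in each direction. -/

namespace RotationSystem

variable {τ : Type*} {T : SimpleGraph τ}

theorem faceNext_injective (R : RotationSystem T) : Function.Injective R.faceNext := by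
  intro d d' h
  have h1 : d.snd = d'.snd := congrArg (fun e => e.fst) h
  have h2 : ((R.rot d.snd ⟨d.fst, d.adj.symm⟩ : T.neighborSet d.snd) : τ) =
      (R.rot d'.snd ⟨d'.fst, d'.adj.symm⟩ : T.neighborSet d'.snd) :=
    congrArg (fun e => e.snd) h
  obtain ⟨⟨a, b⟩, hab⟩ := d
  obtain ⟨⟨a', b'⟩, hab'⟩ := d'
  simp only at h1
  subst h1
  have h3 := (R.rot b).injective (Subtype.ext h2)
  have h4 : a = a' := congrArg Subtype.val h3
  subst h4
  rfl

/-- The segments of the face walk between consecutive leaves have no dart in common. -/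
theorem NextLeaf.eq_of_crossing (R : RotationSystem T) {u v : τ} (huv : T.Adj u v)
    {x y x' y' : τ} (h : R.NextLeaf x y) (h' : R.NextLeaf x' y')
    (hx : (T.deleteEdges {s(u, v)}).Reachable u x) (hy : ¬ (T.deleteEdges {s(u, v)}).Reachable u y)
    (hx' : (T.deleteEdges {s(u, v)}).Reachable u x')
    (hy' : ¬ (T.deleteEdges {s(u, v)}).Reachable u y') : x = x' := by
  -- The dart `(u, v)` is the only one leaving the side of `u`, so each crossing segment traverses
  -- it.
  have cross : ∀ {x y : τ}, (T.deleteEdges {s(u, v)}).Reachable u x →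
      ¬ (T.deleteEdges {s(u, v)}).Reachable u y → ∀ (d : T.Dart) (m : ℕ), d.fst = x →
      (R.faceNext^[m] d).fst = y → ∃ j < m, R.faceNext^[j] d = ⟨(u, v), huv⟩ := by
    intro x y hx hy d m hd hm
    have hex : ∃ j, ¬ (T.deleteEdges {s(u, v)}).Reachable u (R.faceNext^[j] d).fst :=
      ⟨m, hm ▸ hy⟩
    classical
    obtain ⟨j, hj⟩ : ∃ j, Nat.find hex = j + 1 := by
      refine Nat.exists_eq_succ_of_ne_zero fun h0 => ?_
      have := Nat.find_spec hex
      rw [h0] at this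
      exact this (hd ▸ hx)
    have hjm : j + 1 ≤ m := hj ▸ Nat.find_min' hex (hm ▸ hy)
    have h1 : (T.deleteEdges {s(u, v)}).Reachable u (R.faceNext^[j] d).fst := by
      have := Nat.find_min hex (m := j) (by omega)
      exact not_not.1 this
    have h2 : ¬ (T.deleteEdges {s(u, v)}).Reachable u (R.faceNext^[j] d).snd := by
      have := Nat.find_spec hex
      rw [hj, Function.iterate_succ_apply'] at this
      exact this
    refine ⟨j, hjm, ?_⟩
    generalize R.faceNext^[j] d = e at h1 h2
    obtain ⟨⟨a, b⟩, hab⟩ := e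
    by_cases he : s(a, b) = s(u, v)
    · rcases Sym2.eq_iff.1 he with ⟨rfl, rfl⟩ | ⟨rfl, rfl⟩
      · rfl
      · exact absurd (.refl _) h2
    · exact absurd (SimpleGraph.reachable_deleteEdges_of_adj hab he h1) h2
  -- Running both segments back from the common dart, the start of one is met on the other; being a
  -- leaf, it can only be the start of that one too.
  have aux : ∀ {d d' : T.Dart} {i i' m' : ℕ}, i ≤ i' → i' < m' → T.IsLeafVertex d.fst →
      R.faceNext^[i] d = R.faceNext^[i'] d' →
      (∀ j, 0 < j → j < m' → ¬ T.IsLeafVertex (R.faceNext^[j] d').fst) → d.fst = d'.fst := by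
    intro d d' i i' m' hii him hl he hno
    obtain ⟨c, rfl⟩ := Nat.exists_eq_add_of_le hii
    rw [Function.iterate_add_apply] at he
    have he' := R.faceNext_injective.iterate i he
    rcases Nat.eq_zero_or_pos c with rfl | hc
    · rw [he']; rfl
    · exact absurd (he' ▸ hl) (hno c hc (by omega))
  obtain ⟨hl, -, d, m, -, hd, hm, hno⟩ := h
  obtain ⟨hl', -, d', m', -, hd', hm', hno'⟩ := h'
  obtain ⟨i, him, hi⟩ := cross hx hy d m hd hm
  obtain ⟨i', him', hi'⟩ := cross hx' hy' d' m' hd' hm'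
  subst hd hd'
  rcases le_total i i' with hii | hii
  · exact aux hii him' hl (hi.trans hi'.symm) hno'
  · exact (aux hii him hl' (hi'.trans hi.symm) hno).symm

end RotationSystem

/-- A set of indices that is neither empty nor everything is left by the rotation. -/
theorem exists_finRotate_leaving {l : ℕ} {P : Fin l → Prop} {a b : Fin l} (ha : P a) (hb : ¬ P b) :
    ∃ j, P j ∧ ¬ P (finRotate l j) := by
  by_contra! h
  have key : ∀ m : ℕ, P ((finRotate l)^[m] a) := by
    intro m
    induction m with
    | zero => exact ha
    | succ m ih => rw [Function.iterate_succ_apply']; exact h _ ih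
  have : NeZero l := NeZero.of_pos a.pos
  have := key (b - a).1
  rw [← finCycle_eq_finRotate_iterate, finCycle_apply, add_sub_cancel] at this
  exact hb this

/-! ### The retraction of the join onto a piece. -/

namespace HajosTree

variable {α : Type*} {n : ℕ} (J : HajosTree α n)

theorem adj_uv (i : Fin n) : J.T.Adj (J.u i) (J.v i) := by
  rw [← SimpleGraph.mem_edgeSet, ← J.range_edge]
  exact ⟨i, rfl⟩

theorem exists_edge {s t : J.treeVerts} (h : J.T.Adj s t) : ∃ i, s(J.u i, J.v i) = s(s, t) := by
  have h : s(s, t) ∈ J.T.edgeSet := h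
  rwa [← J.range_edge] at h

theorem u_mem (i : Fin n) : (J.u i : α) ∈ (J.D i).verts := ((J.D i).arcs_subset _ (J.digon i).1).1

theorem v_mem (i : Fin n) : (J.v i : α) ∈ (J.D i).verts := ((J.D i).arcs_subset _ (J.digon i).1).2

theorem u_ne_v (i : Fin n) : (J.u i : α) ≠ J.v i := (J.D i).loopless _ (J.digon i).1

theorem coe_mem_verts_iff {i : Fin n} {t : J.treeVerts} :
    (t : α) ∈ (J.D i).verts ↔ t = J.u i ∨ t = J.v i := by
  constructor
  · intro h
    have : (t : α) ∈ (J.D i).verts ∩ J.treeVerts := ⟨h, t.2⟩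
    rw [J.verts_inter] at this
    exact this.imp Subtype.ext Subtype.ext
  · rintro (rfl | rfl)
    · exact J.u_mem i
    · exact J.v_mem i

theorem exists_coe_of_mem_mem {i j : Fin n} (hij : i ≠ j) {w : α} (hi : w ∈ (J.D i).verts)
    (hj : w ∈ (J.D j).verts) : ∃ t : J.treeVerts, (t : α) = w := by
  by_contra! h
  have hx : w ∈ ((J.D i).verts \ {(J.u i : α), (J.v i : α)}) ∩
      ((J.D j).verts \ {(J.u j : α), (J.v j : α)}) := by
    refine ⟨⟨hi, ?_⟩, hj, ?_⟩ <;> rintro (e | e) <;> exact h _ e.symm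
  rw [J.disjoint i j hij] at hx
  exact hx

theorem nontrivial_treeVerts : Nontrivial J.treeVerts := ⟨_, _, (J.adj_uv ⟨0, J.n_pos⟩).ne⟩

theorem exists_mem_verts (t : J.treeVerts) : ∃ i, (t : α) ∈ (J.D i).verts := by
  have := J.nontrivial_treeVerts
  obtain ⟨y, hy⟩ := J.isTree.connected.preconnected.exists_adj_of_nontrivial t
  obtain ⟨i, hi⟩ := J.exists_edge hy
  refine ⟨i, J.coe_mem_verts_iff.2 ?_⟩
  rcases Sym2.eq_iff.1 hi with ⟨h, -⟩ | ⟨-, h⟩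
  · exact .inl h.symm
  · exact .inr h.symm

instance finite_treeVerts : Finite J.treeVerts := by
  have : (Set.range J.u ∪ Set.range J.v) = Set.univ := by
    refine Set.eq_univ_of_forall fun t => ?_
    obtain ⟨i, hi⟩ := J.exists_mem_verts t
    rcases J.coe_mem_verts_iff.1 hi with h | h
    · exact .inl ⟨i, h.symm⟩
    · exact .inr ⟨i, h.symm⟩
  exact Set.finite_univ_iff.1 (this ▸ (Set.finite_range _).union (Set.finite_range _))

/-- `t` is on the side of `uᵢ` when the edge `uᵢvᵢ` is removed from the tree. -/
def Side (i : Fin n) (t : J.treeVerts) : Prop :=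
  (J.T.deleteEdges {s(J.u i, J.v i)}).Reachable (J.u i) t

theorem side_u (i : Fin n) : J.Side i (J.u i) := .refl _

theorem not_side_v (i : Fin n) : ¬ J.Side i (J.v i) :=
  J.isTree.not_reachable_deleteEdges (J.adj_uv i)

theorem side_iff_of_adj {i : Fin n} {s t : J.treeVerts} (h : J.T.Adj s t)
    (hne : s(s, t) ≠ s(J.u i, J.v i)) : J.Side i s ↔ J.Side i t :=
  ⟨SimpleGraph.reachable_deleteEdges_of_adj h hne,
    SimpleGraph.reachable_deleteEdges_of_adj h.symm (by rwa [Sym2.eq_swap])⟩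

theorem not_side_iff {i : Fin n} {t : J.treeVerts} :
    ¬ J.Side i t ↔ (J.T.deleteEdges {s(J.u i, J.v i)}).Reachable (J.v i) t := by
  refine ⟨(J.isTree.connected.reachable_deleteEdges_or _ _ t).resolve_left, fun h h' => ?_⟩
  exact J.not_side_v i (SimpleGraph.Reachable.trans h' h.symm)

theorem side_v_iff {i j : Fin n} (hij : j ≠ i) : J.Side i (J.v j) ↔ J.Side i (J.u j) :=
  (J.side_iff_of_adj (J.adj_uv j) fun h => hij (J.edge_injective h)).symm

theorem side_iff_of_mem {i j : Fin n} (hij : j ≠ i) {t : J.treeVerts}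
    (ht : (t : α) ∈ (J.D j).verts) : J.Side i t ↔ J.Side i (J.u j) := by
  rcases J.coe_mem_verts_iff.1 ht with rfl | rfl
  · rfl
  · exact J.side_v_iff hij

open Classical in
/-- The retraction of the tree join onto `Dᵢ`: the part on the side of `uᵢ` is mapped to `uᵢ` and
the part on the side of `vᵢ` is mapped to `vᵢ`. -/
noncomputable def retr (i : Fin n) (w : α) : α :=
  if w ∈ (J.D i).verts then w
  else if ∃ j, j ≠ i ∧ w ∈ (J.D j).verts ∧ J.Side i (J.u j) then J.u i else J.v i

theorem retr_of_mem {i : Fin n} {w : α} (h : w ∈ (J.D i).verts) : J.retr i w = w := if_pos h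

theorem retr_mem (i : Fin n) (w : α) : J.retr i w ∈ (J.D i).verts := by
  unfold retr
  split_ifs with h1 h2
  · exact h1
  · exact J.u_mem i
  · exact J.v_mem i

theorem retr_of_notMem {i : Fin n} {w : α} (h : w ∉ (J.D i).verts) :
    J.retr i w = J.u i ∨ J.retr i w = J.v i := by
  unfold retr
  rw [if_neg h]
  split_ifs
  · exact .inl rfl
  · exact .inr rfl

open Classical in
-- The image does not depend on the choice of `j`: two pieces share only tree vertices, and the ends
-- of an edge other than the `i`-th lie on the same side.
theorem retr_of_mem_ne {i j : Fin n} (hij : j ≠ i) {w : α} (hw : w ∈ (J.D j).verts) :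
    J.retr i w = if J.Side i (J.u j) then (J.u i : α) else J.v i := by
  by_cases hi : w ∈ (J.D i).verts
  · obtain ⟨t, rfl⟩ := J.exists_coe_of_mem_mem hij hw hi
    rw [J.retr_of_mem hi]
    have hs := J.side_iff_of_mem hij hw
    rcases J.coe_mem_verts_iff.1 hi with rfl | rfl
    · rw [if_pos (hs.1 (J.side_u i))]
    · rw [if_neg (mt hs.2 (J.not_side_v i))]
  · have : (∃ j, j ≠ i ∧ w ∈ (J.D j).verts ∧ J.Side i (J.u j)) ↔ J.Side i (J.u j) := by
      refine ⟨?_, fun h => ⟨j, hij, hw, h⟩⟩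
      rintro ⟨j', hj', hw', h⟩
      by_cases hjj : j' = j
      · exact hjj ▸ h
      · obtain ⟨t, rfl⟩ := J.exists_coe_of_mem_mem hjj hw' hw
        rwa [← J.side_iff_of_mem hj' hw', J.side_iff_of_mem hij hw] at h
    unfold retr
    rw [if_neg hi]
    simp only [this]

open Classical in
theorem retr_coe (i : Fin n) (t : J.treeVerts) :
    J.retr i t = if J.Side i t then (J.u i : α) else J.v i := by
  obtain ⟨j, hj⟩ := J.exists_mem_verts t
  by_cases hij : j = i
  · subst hij
    rw [J.retr_of_mem hj]
    rcases J.coe_mem_verts_iff.1 hj with rfl | rfl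
    · rw [if_pos (J.side_u j)]
    · rw [if_neg (J.not_side_v j)]
  · rw [J.retr_of_mem_ne hij hj]
    simp only [J.side_iff_of_mem hij hj]

theorem retr_coe_eq_u {i : Fin n} {t : J.treeVerts} : J.retr i t = J.u i ↔ J.Side i t := by
  rw [J.retr_coe]
  split_ifs with h
  · simp [h]
  · simp [h, (J.u_ne_v i).symm]

theorem retr_coe_eq_v {i : Fin n} {t : J.treeVerts} : J.retr i t = J.v i ↔ ¬ J.Side i t := by
  rw [J.retr_coe]
  split_ifs with h
  · simp [h, J.u_ne_v i]
  · simp [h]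

/-- Distinct vertices of the join are told apart by one of the retractions. -/
theorem exists_retr_ne {x y : α} (hx : x ∈ J.join.verts) (hy : y ∈ J.join.verts) (hxy : x ≠ y) :
    ∃ i, J.retr i x ≠ J.retr i y := by
  by_contra! h
  -- If all images agree, no piece contains both vertices. In a piece containing `x`, the vertex `y`
  -- is therefore collapsed to an end of the tree edge, and this end is `x`.
  have key : ∀ {x y : α}, x ∈ J.join.verts → x ≠ y → (∀ i, J.retr i x = J.retr i y) →
      ∃ t : J.treeVerts, (t : α) = x := by
    intro x y hx hxy h
    obtain ⟨i, hi⟩ := Set.mem_iUnion.1 hx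
    have hy : y ∉ (J.D i).verts := fun hy => hxy (by
      rw [← J.retr_of_mem hi, h i, J.retr_of_mem hy])
    have := h i
    rw [J.retr_of_mem hi] at this
    rcases J.retr_of_notMem hy with e | e
    · exact ⟨_, (this.trans e).symm⟩
    · exact ⟨_, (this.trans e).symm⟩
  obtain ⟨s, rfl⟩ := key hx hxy h
  obtain ⟨t, rfl⟩ := key hy hxy.symm fun i => (h i).symm
  have hst : s ≠ t := fun e => hxy (congrArg _ e)
  obtain ⟨w, hw, hr⟩ := J.isTree.connected.exists_adj_reachable hst
  obtain ⟨i, hi⟩ := J.exists_edge hw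
  have hi' := h i
  rw [← hi] at hr
  rcases Sym2.eq_iff.1 hi with ⟨rfl, rfl⟩ | ⟨rfl, rfl⟩
  · rw [J.retr_coe_eq_u.2 (J.side_u i)] at hi'
    exact (J.not_side_iff.2 hr) (J.retr_coe_eq_u.1 hi'.symm)
  · rw [J.retr_coe_eq_v.2 (J.not_side_v i)] at hi'
    exact J.retr_coe_eq_v.1 hi'.symm hr

/-- The arcs of `Dᵢ - [uᵢ, vᵢ]`. -/
def part (i : Fin n) : Set (α × α) :=
  (J.D i).arcs \ {((J.u i : α), (J.v i : α)), ((J.v i : α), (J.u i : α))}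

theorem mem_join_arcs {e : α × α} : e ∈ J.join.arcs ↔
    (∃ i, e ∈ J.part i) ∨ ∃ j, ((J.C j : α), (J.C (finRotate J.ℓ j) : α)) = e := by
  change e ∈ (⋃ i, J.part i) ∪ Set.range _ ↔ _
  rw [Set.mem_union, Set.mem_iUnion, Set.mem_range]

theorem part_subset_join (i : Fin n) : J.part i ⊆ J.join.arcs := fun _ he =>
  J.mem_join_arcs.2 (.inl ⟨i, he⟩)

theorem C_mem_join (j : Fin J.ℓ) : ((J.C j : α), (J.C (finRotate J.ℓ j) : α)) ∈ J.join.arcs :=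
  J.mem_join_arcs.2 (.inr ⟨j, rfl⟩)

theorem verts_subset_join (i : Fin n) : (J.D i).verts ⊆ J.join.verts :=
  Set.subset_iUnion_of_subset i subset_rfl

theorem coe_mem_join (t : J.treeVerts) : (t : α) ∈ J.join.verts := by
  obtain ⟨i, hi⟩ := J.exists_mem_verts t
  exact J.verts_subset_join i hi

theorem part_mem {i : Fin n} {e : α × α} (h : e ∈ J.part i) :
    e.1 ∈ (J.D i).verts ∧ e.2 ∈ (J.D i).verts := (J.D i).arcs_subset e h.1

theorem retr_eq_of_part_ne {i j : Fin n} (hij : j ≠ i) {e : α × α} (h : e ∈ J.part j) :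
    J.retr i e.1 = J.retr i e.2 := by
  rw [J.retr_of_mem_ne hij (J.part_mem h).1, J.retr_of_mem_ne hij (J.part_mem h).2]

theorem exists_C {t : J.treeVerts} (h : J.T.IsLeafVertex t) : ∃ j, J.C j = t := by
  have : t ∈ {x | J.T.IsLeafVertex x} := h
  rwa [← J.range_C] at this

theorem exists_C_side (i : Fin n) : ∃ j, J.Side i (J.C j) := by
  obtain ⟨t, ht, hr⟩ := J.isTree.exists_isLeafVertex_reachable (J.adj_uv i).symm
  obtain ⟨j, rfl⟩ := J.exists_C ht
  exact ⟨j, by rwa [Sym2.eq_swap] at hr⟩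

theorem exists_C_not_side (i : Fin n) : ∃ j, ¬ J.Side i (J.C j) := by
  obtain ⟨t, ht, hr⟩ := J.isTree.exists_isLeafVertex_reachable (J.adj_uv i)
  obtain ⟨j, rfl⟩ := J.exists_C ht
  exact ⟨j, J.not_side_iff.2 hr⟩

theorem exists_C_crossing (i : Fin n) :
    ∃ j, J.Side i (J.C j) ∧ ¬ J.Side i (J.C (finRotate J.ℓ j)) := by
  obtain ⟨a, ha⟩ := J.exists_C_side i
  obtain ⟨b, hb⟩ := J.exists_C_not_side i
  exact exists_finRotate_leaving (P := fun j => J.Side i (J.C j)) ha hb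

theorem exists_C_crossing' (i : Fin n) :
    ∃ j, ¬ J.Side i (J.C j) ∧ J.Side i (J.C (finRotate J.ℓ j)) := by
  obtain ⟨a, ha⟩ := J.exists_C_side i
  obtain ⟨b, hb⟩ := J.exists_C_not_side i
  simpa using exists_finRotate_leaving (P := fun j => ¬ J.Side i (J.C j)) hb (not_not.2 ha)

/-- With `exists_C_crossing`, exactly one arc of `C` leads from the side of `uᵢ` to the side of
`vᵢ`; it stands for the arc `uᵢvᵢ`. -/
theorem C_crossing_unique {i : Fin n} {j j' : Fin J.ℓ} (h1 : J.Side i (J.C j))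
    (h2 : ¬ J.Side i (J.C (finRotate J.ℓ j))) (h1' : J.Side i (J.C j'))
    (h2' : ¬ J.Side i (J.C (finRotate J.ℓ j'))) : j = j' :=
  J.C_injective (RotationSystem.NextLeaf.eq_of_crossing J.R (J.adj_uv i) (J.C_natural j)
    (J.C_natural j') h1 h2 h1' h2')

theorem C_crossing_unique' {i : Fin n} {j j' : Fin J.ℓ} (h1 : ¬ J.Side i (J.C j))
    (h2 : J.Side i (J.C (finRotate J.ℓ j))) (h1' : ¬ J.Side i (J.C j'))
    (h2' : J.Side i (J.C (finRotate J.ℓ j'))) : j = j' := by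
  rw [← not_not (a := J.Side i _), not_side_iff, Sym2.eq_swap] at h2 h2'
  rw [not_side_iff, Sym2.eq_swap] at h1 h1'
  exact J.C_injective (RotationSystem.NextLeaf.eq_of_crossing J.R (J.adj_uv i).symm
    (J.C_natural j) (J.C_natural j') h1 h2 h1' h2')

/-- An arc of the join with distinct images under the `i`-th retraction. -/
theorem join_arc_cases (i : Fin n) {e : α × α} (he : e ∈ J.join.arcs) :
    J.retr i e.1 = J.retr i e.2 ∨ (e ∈ J.part i ∧ J.retr i e.1 = e.1 ∧ J.retr i e.2 = e.2) ∨
      ∃ j, ((J.C j : α), (J.C (finRotate J.ℓ j) : α)) = e ∧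
        ((J.Side i (J.C j) ∧ ¬ J.Side i (J.C (finRotate J.ℓ j)) ∧
          J.retr i e.1 = J.u i ∧ J.retr i e.2 = J.v i) ∨
        (¬ J.Side i (J.C j) ∧ J.Side i (J.C (finRotate J.ℓ j)) ∧
          J.retr i e.1 = J.v i ∧ J.retr i e.2 = J.u i)) := by
  rcases J.mem_join_arcs.1 he with ⟨i', hi'⟩ | ⟨j, rfl⟩
  · by_cases h : i' = i
    · subst h
      exact .inr (.inl ⟨hi', J.retr_of_mem (J.part_mem hi').1, J.retr_of_mem (J.part_mem hi').2⟩)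
    · exact .inl (J.retr_eq_of_part_ne h hi')
  · by_cases h1 : J.Side i (J.C j) <;> by_cases h2 : J.Side i (J.C (finRotate J.ℓ j))
    · exact .inl ((J.retr_coe_eq_u.2 h1).trans (J.retr_coe_eq_u.2 h2).symm)
    · exact .inr (.inr ⟨j, rfl, .inl ⟨h1, h2, J.retr_coe_eq_u.2 h1, J.retr_coe_eq_v.2 h2⟩⟩)
    · exact .inr (.inr ⟨j, rfl, .inr ⟨h1, h2, J.retr_coe_eq_v.2 h1, J.retr_coe_eq_u.2 h2⟩⟩)
    · exact .inl ((J.retr_coe_eq_v.2 h1).trans (J.retr_coe_eq_v.2 h2).symm)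

theorem retr_arc_mem (i : Fin n) {e : α × α} (he : e ∈ J.join.arcs)
    (hne : J.retr i e.1 ≠ J.retr i e.2) : (J.retr i e.1, J.retr i e.2) ∈ (J.D i).arcs := by
  rcases J.join_arc_cases i he with h | ⟨h, h1, h2⟩ | ⟨j, -, ⟨-, -, h1, h2⟩ | ⟨-, -, h1, h2⟩⟩
  · exact absurd h hne
  · rw [h1, h2]; exact h.1
  · rw [h1, h2]; exact (J.digon i).1
  · rw [h1, h2]; exact (J.digon i).2

/-- Arcs of `part i` are fixed, and the two crossing arcs of `C` go to the digon, which `part i`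
does not contain. -/
theorem retr_arc_injOn (i : Fin n) :
    Set.InjOn (fun e : α × α => (J.retr i e.1, J.retr i e.2))
      {e ∈ J.join.arcs | J.retr i e.1 ≠ J.retr i e.2} := by
  have part_ne : ∀ {e e' : α × α}, e ∈ J.part i → J.retr i e.1 = e.1 → J.retr i e.2 = e.2 →
      ((J.retr i e'.1 = J.u i ∧ J.retr i e'.2 = J.v i) ∨
        (J.retr i e'.1 = J.v i ∧ J.retr i e'.2 = J.u i)) →
      (J.retr i e.1, J.retr i e.2) ≠ (J.retr i e'.1, J.retr i e'.2) := by
    intro e e' he h1 h2 h h'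
    rw [h1, h2, Prod.mk.eta] at h'
    rcases h with ⟨h3, h4⟩ | ⟨h3, h4⟩ <;> rw [h3, h4] at h' <;> subst h'
    · exact he.2 (.inl rfl)
    · exact he.2 (.inr rfl)
  rintro e ⟨he, hne⟩ e' ⟨he', hne'⟩ heq
  have heq : (J.retr i e.1, J.retr i e.2) = (J.retr i e'.1, J.retr i e'.2) := heq
  rcases J.join_arc_cases i he with h | ⟨h, h1, h2⟩ | ⟨j, hj, h⟩
  · exact absurd h hne
  · rcases J.join_arc_cases i he' with h' | ⟨h', h1', h2'⟩ | ⟨j', -, h'⟩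
    · exact absurd h' hne'
    · rwa [h1, h2, h1', h2'] at heq
    · exact absurd heq (part_ne h h1 h2 (h'.imp (fun h => h.2.2) fun h => h.2.2))
  · rcases J.join_arc_cases i he' with h' | ⟨h', h1', h2'⟩ | ⟨j', hj', h'⟩
    · exact absurd h' hne'
    · exact absurd heq.symm (part_ne h' h1' h2' (h.imp (fun h => h.2.2) fun h => h.2.2))
    · have e1 := congrArg Prod.fst heq
      simp only at e1
      suffices j = j' by rw [← hj, ← hj', this]
      rcases h with ⟨a, b, c, -⟩ | ⟨a, b, c, -⟩ <;> rcases h' with ⟨p, q, c', -⟩ | ⟨p, q, c', -⟩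
      · exact J.C_crossing_unique a b p q
      · exact absurd (c.symm.trans (e1.trans c')) (J.u_ne_v i)
      · exact absurd (c'.symm.trans (e1.symm.trans c)) (J.u_ne_v i)
      · exact J.C_crossing_unique' a b p q

/-- Cuts of `Dᵢ` pull back to cuts of the join that are not larger. -/
theorem ncard_outArcs_preimage_le (i : Fin n) (X : Set α) :
    (J.join.outArcs (J.retr i ⁻¹' X)).ncard ≤ ((J.D i).outArcs X).ncard := by
  have hne : ∀ e ∈ J.join.outArcs (J.retr i ⁻¹' X), J.retr i e.1 ≠ J.retr i e.2 :=
    fun e he h => he.2.2 (by rw [Set.mem_preimage, ← h]; exact he.2.1)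
  have hsub : J.join.outArcs (J.retr i ⁻¹' X) ⊆
      {e ∈ J.join.arcs | J.retr i e.1 ≠ J.retr i e.2} := fun e he => ⟨he.1, hne e he⟩
  refine Set.ncard_le_ncard_of_injOn (fun e => (J.retr i e.1, J.retr i e.2)) (fun e he => ?_)
    ((J.retr_arc_injOn i).mono hsub) ((J.D i).finite_outArcs X)
  exact ⟨J.retr_arc_mem i he.1 (hne e he), he.2⟩

/-- If all cuts of `Dᵢ` have at least two arcs then `Dᵢ - [uᵢ, vᵢ]` is strong. -/
theorem exists_part_leaving {i : Fin n} {X : Set α} (h : 2 ≤ ((J.D i).outArcs X).ncard) :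
    ∃ e ∈ J.part i, e.1 ∈ X ∧ e.2 ∉ X := by
  by_contra! hno
  have hsub : (J.D i).outArcs X ⊆ {((J.u i : α), (J.v i : α)), ((J.v i : α), (J.u i : α))} := by
    intro e he
    by_contra he'
    exact he.2.2 (hno e ⟨he.1, he'⟩ he.2.1)
  obtain ⟨e, he, e', he', hne⟩ := (Set.one_lt_ncard ((J.D i).finite_outArcs X)).1 h
  -- Two opposite arcs cannot both leave `X`.
  rcases hsub he with rfl | rfl <;> rcases hsub he' with rfl | rfl
  · exact hne rfl
  · exact he.2.2 he'.2.1
  · exact he.2.2 he'.2.1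
  · exact hne rfl

end HajosTree

theorem SimpleGraph.Reachable.induction_of_adj {V : Type*} {G : SimpleGraph V} {P : V → Prop}
    {s t : V} (h : G.Reachable s t) (hP : ∀ a b, G.Adj a b → P a → P b) (hs : P s) : P t := by
  obtain ⟨p⟩ := h
  induction p with
  | nil => exact hs
  | cons hadj _ ih => exact ih (hP _ _ hadj hs)

/-- If `d ≠ c`, the colour `d` is sent to a third colour, different from `p` and `s`. This is where
the converse needs three colours. -/
theorem exists_perm_apply_eq_apply_ne {k : ℕ} (hk : 3 ≤ k) (c d : Fin k) {p s : Fin k}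
    (hps : p ≠ s) : ∃ σ : Equiv.Perm (Fin k), σ c = p ∧ σ d ≠ s := by
  by_cases hcd : d = c
  · exact ⟨Equiv.swap c p, by simp, by simpa [hcd] using hps⟩
  · obtain ⟨q, hq⟩ : ∃ q, q ∉ ({p, s} : Finset (Fin k)) := by
      by_contra! h
      have h1 := Finset.card_le_card fun q (_ : q ∈ Finset.univ) => h q
      have h2 := Finset.card_le_two (a := p) (b := s)
      rw [Finset.card_univ, Fintype.card_fin] at h1
      omega
    simp only [Finset.mem_insert, Finset.mem_singleton, not_or] at hq
    have hd : Equiv.swap c p d ≠ p := fun h =>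
      hcd ((Equiv.swap c p).injective (h.trans (Equiv.swap_apply_left c p).symm))
    refine ⟨(Equiv.swap c p).trans (Equiv.swap (Equiv.swap c p d) q), ?_, ?_⟩
    · rw [Equiv.trans_apply, Equiv.swap_apply_left,
        Equiv.swap_apply_of_ne_of_ne hd.symm (Ne.symm hq.1)]
    · rw [Equiv.trans_apply, Equiv.swap_apply_left]
      exact hq.2

/-! ### From the pieces to the join. -/

namespace HajosTree

variable {α : Type*} {n : ℕ} {J : HajosTree α n}

/-- All cuts of the pieces have at least two arcs. -/
def TwoArcConnected (J : HajosTree α n) : Prop :=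
  ∀ (i : Fin n) (X : Set α), (∃ x ∈ (J.D i).verts, x ∈ X) → (∃ y ∈ (J.D i).verts, y ∉ X) →
    2 ≤ ((J.D i).outArcs X).ncard

theorem TwoArcConnected.mem_of_closed (H : J.TwoArcConnected) {i : Fin n} {X : Set α}
    (hX : ∀ e ∈ J.part i, e.1 ∈ X → e.2 ∈ X) {x y : α} (hx : x ∈ (J.D i).verts) (hxX : x ∈ X)
    (hy : y ∈ (J.D i).verts) : y ∈ X := by
  by_contra hyX
  obtain ⟨e, he, h1, h2⟩ := J.exists_part_leaving (H i X ⟨x, hx, hxX⟩ ⟨y, hy, hyX⟩)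
  exact h2 (hX e he h1)

theorem exists_edge_mem {s t : J.treeVerts} (h : J.T.Adj s t) :
    ∃ i, s(J.u i, J.v i) = s(s, t) ∧ (s : α) ∈ (J.D i).verts ∧ (t : α) ∈ (J.D i).verts := by
  obtain ⟨i, hi⟩ := J.exists_edge h
  refine ⟨i, hi, ?_⟩
  rcases Sym2.eq_iff.1 hi with ⟨rfl, rfl⟩ | ⟨rfl, rfl⟩
  · exact ⟨J.u_mem i, J.v_mem i⟩
  · exact ⟨J.v_mem i, J.u_mem i⟩

/-- Already without `C`: the pieces stay strong after losing their digons, and they hang together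
along the tree. -/
theorem TwoArcConnected.isStrong_join (H : J.TwoArcConnected) : J.join.IsStrong := by
  refine FinDigraph.isStrong_of_outArcs_nonempty ?_
  rintro X ⟨x, hx, hxX⟩ ⟨y, hy, hyX⟩
  by_contra hne
  have hX : ∀ e ∈ J.join.arcs, e.1 ∈ X → e.2 ∈ X := fun e he h1 => by
    by_contra h2
    exact hne ⟨e, he, h1, h2⟩
  have hP : ∀ i, ∀ x ∈ (J.D i).verts, x ∈ X → ∀ y ∈ (J.D i).verts, y ∈ X := fun i x hx hxX y hy =>
    H.mem_of_closed (fun e he => hX e (J.part_subset_join i he)) hx hxX hy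
  obtain ⟨i, hi⟩ := Set.mem_iUnion.1 hx
  obtain ⟨j, hj⟩ := Set.mem_iUnion.1 hy
  refine hyX (hP j (J.u j) (J.u_mem j) ?_ y hj)
  refine (J.isTree.connected.preconnected (J.u i) (J.u j)).induction_of_adj
    (P := fun t : J.treeVerts => (t : α) ∈ X) (fun a b hab ha => ?_) (hP i x hi hxX _ (J.u_mem i))
  obtain ⟨l, -, h1, h2⟩ := J.exists_edge_mem hab
  exact hP l a h1 ha b h2

theorem part_ne_coe {i : Fin n} {e : α × α} (he : e ∈ J.part i) (s t : J.treeVerts) :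
    e ≠ ((s : α), (t : α)) := by
  rintro rfl
  have h1 := J.coe_mem_verts_iff.1 (J.part_mem he).1
  have h2 := J.coe_mem_verts_iff.1 (J.part_mem he).2
  have h3 := (J.D i).loopless _ he.1
  rcases h1 with rfl | rfl <;> rcases h2 with rfl | rfl
  · exact h3 rfl
  · exact he.2 (.inl rfl)
  · exact he.2 (.inr rfl)
  · exact h3 rfl

section Biconnected

variable {z : α} {S : Set α}

theorem TwoArcConnected.mem_of_isClosedAvoiding (H : J.TwoArcConnected)
    (hS : J.join.IsClosedAvoiding z S) {i : Fin n} (hz : z ∉ (J.D i).verts) {x y : α}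
    (hx : x ∈ (J.D i).verts) (hxS : x ∈ S) (hy : y ∈ (J.D i).verts) : y ∈ S := by
  refine H.mem_of_closed (fun e he h => ?_) hx hxS hy
  exact hS.closed _ h _ (fun h => hz (h ▸ (J.part_mem he).2)) (.inl (J.part_subset_join i he))

/-- If `S` contained no tree vertex, its trace on a piece would not touch the digon and would be
closed in that piece; biconnectivity would then put an end of the tree edge into `S`. -/
theorem exists_coe_mem_of_isClosedAvoiding (hb : ∀ i, (J.D i).IsBiconnected)
    (hS : J.join.IsClosedAvoiding z S) : ∃ t : J.treeVerts, (t : α) ∈ S := by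
  by_contra! hno
  obtain ⟨w, hw⟩ := hS.nonempty
  obtain ⟨i, hi⟩ := Set.mem_iUnion.1 (hS.subset hw)
  -- If `z` is not in the piece, any vertex of the piece outside `S` can take its place.
  obtain ⟨z', hz', hzS, hzz⟩ : ∃ z' ∈ (J.D i).verts, z' ∉ S ∧ (z ∈ (J.D i).verts → z' = z) := by
    by_cases hz : z ∈ (J.D i).verts
    · exact ⟨z, hz, hS.notMem, fun _ => rfl⟩
    · exact ⟨J.u i, J.u_mem i, hno _, fun h => absurd h hz⟩
  have hS' : (J.D i).IsClosedAvoiding z' (S ∩ (J.D i).verts) := by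
    refine ⟨Set.inter_subset_right, ⟨w, hw, hi⟩, fun h => hzS h.1, ?_⟩
    rintro a ⟨haS, -⟩ b hbz hab
    refine ⟨hS.closed a haS b (fun h => hbz ?_) ?_, hab.mem.2⟩
    · rw [hzz (h ▸ hab.mem.2), h]
    · have hau : a ≠ J.u i := fun h => hno _ (h ▸ haS)
      have hav : a ≠ J.v i := fun h => hno _ (h ▸ haS)
      refine hab.imp (fun h => J.part_subset_join i ⟨h, ?_⟩)
        (fun h => J.part_subset_join i ⟨h, ?_⟩) <;>
      · simp only [Set.mem_insert_iff, Set.mem_singleton_iff, Prod.mk.injEq]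
        tauto
  by_cases hu : (J.u i : α) = z'
  · exact hno _ ((hb i).eq_of_isClosedAvoiding hz' hS' (J.v_mem i)
      (fun h => J.u_ne_v i (hu.trans h.symm))).1
  · exact hno _ ((hb i).eq_of_isClosedAvoiding hz' hS' (J.u_mem i) hu).1

/-- From a tree vertex in `S`, one moves through pieces avoiding `z` to a leaf. If `z` is a tree
vertex, this is done within a branch at `z`; otherwise, within one side of the edge whose piece
contains `z`. -/
theorem TwoArcConnected.exists_C_mem (H : J.TwoArcConnected) (hb : ∀ i, (J.D i).IsBiconnected)
    (hz : z ∈ J.join.verts) (hS : J.join.IsClosedAvoiding z S) : ∃ j, (J.C j : α) ∈ S := by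
  obtain ⟨t, ht⟩ := exists_coe_mem_of_isClosedAvoiding hb hS
  by_cases hzt : ∃ s : J.treeVerts, (s : α) = z
  · obtain ⟨s, rfl⟩ := hzt
    have hst : s ≠ t := fun h => hS.notMem (h ▸ ht)
    obtain ⟨w, hw, hr⟩ := J.isTree.connected.exists_adj_reachable hst
    obtain ⟨y, hy, hr'⟩ := J.isTree.exists_isLeafVertex_reachable hw
    obtain ⟨j, rfl⟩ := J.exists_C hy
    refine ⟨j, ((hr.symm.trans hr').induction_of_adj
      (P := fun a : J.treeVerts => (a : α) ∈ S ∧ (J.T.deleteEdges {s(s, w)}).Reachable w a)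
      (fun a b hab ha => ?_) ⟨ht, hr⟩).1⟩
    have hb' := ha.2.trans hab.reachable
    refine ⟨?_, hb'⟩
    obtain ⟨l, hl, h1, h2⟩ := J.exists_edge_mem (SimpleGraph.deleteEdges_le _ hab)
    refine H.mem_of_isClosedAvoiding hS (fun hs => ?_) h1 ha.1 h2
    rw [J.coe_mem_verts_iff] at hs
    have hs' : s = a ∨ s = b := by
      rcases Sym2.eq_iff.1 hl with ⟨rfl, rfl⟩ | ⟨rfl, rfl⟩
      · exact hs
      · exact hs.symm
    rcases hs' with rfl | rfl
    · exact hS.notMem ha.1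
    · exact J.isTree.not_reachable_deleteEdges hw hb'.symm
  · obtain ⟨i, hi⟩ := Set.mem_iUnion.1 hz
    obtain ⟨j, hj⟩ : ∃ j, (J.T.deleteEdges {s(J.u i, J.v i)}).Reachable t (J.C j) := by
      by_cases hs : J.Side i t
      · obtain ⟨j, hj⟩ := J.exists_C_side i
        exact ⟨j, hs.symm.trans hj⟩
      · obtain ⟨j, hj⟩ := J.exists_C_not_side i
        exact ⟨j, (J.not_side_iff.1 hs).symm.trans (J.not_side_iff.1 hj)⟩
    refine ⟨j, hj.induction_of_adj (P := fun a : J.treeVerts => (a : α) ∈ S)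
      (fun a b hab ha => ?_) ht⟩
    rw [SimpleGraph.deleteEdges_adj] at hab
    obtain ⟨l, hl, h1, h2⟩ := J.exists_edge_mem hab.1
    refine H.mem_of_isClosedAvoiding hS (fun hs => ?_) h1 ha h2
    refine hzt (J.exists_coe_of_mem_mem (i := l) (j := i) ?_ hs hi)
    rintro rfl
    exact hab.2 hl.symm

/-- If `z` separated `S` from the rest, `C` would have to pass through `z` both on leaving `S` and
on leaving the rest, but it visits `z` at most once. -/
theorem TwoArcConnected.isBiconnected_join (H : J.TwoArcConnected)
    (hb : ∀ i, (J.D i).IsBiconnected) : J.join.IsBiconnected := by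
  refine FinDigraph.isBiconnected_of_isStrong H.isStrong_join
    ⟨_, J.coe_mem_join (J.u ⟨0, J.n_pos⟩)⟩ fun z hz S hS b hb' hbz => ?_
  by_contra hbS
  have hS' : J.join.IsClosedAvoiding z {w | w ∈ J.join.verts ∧ w ≠ z ∧ w ∉ S} := by
    refine ⟨fun w hw => hw.1, ⟨b, hb', hbz, hbS⟩, fun h => h.2.1 rfl, ?_⟩
    rintro c ⟨hc, hcz, hcS⟩ d hdz hcd
    exact ⟨hcd.mem.2, hdz, fun hd => hcS (hS.closed d hd c hcz hcd.symm)⟩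
  obtain ⟨p, hp⟩ := H.exists_C_mem hb hz hS
  obtain ⟨q, hq⟩ := H.exists_C_mem hb hz hS'
  obtain ⟨a, ha, ha'⟩ := exists_finRotate_leaving (P := fun j => (J.C j : α) ∈ S) hp hq.2.2
  obtain ⟨c, hc, hc'⟩ := exists_finRotate_leaving
    (P := fun j => (J.C j : α) ∈ {w | w ∈ J.join.verts ∧ w ≠ z ∧ w ∉ S}) hq fun h => h.2.2 hp
  have e1 : (J.C (finRotate J.ℓ a) : α) = z := by
    by_contra h
    exact ha' (hS.closed _ ha _ h (.inl (J.C_mem_join a)))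
  have e2 : (J.C (finRotate J.ℓ c) : α) = z := by
    by_contra h
    exact hc' (hS'.closed _ hc _ h (.inl (J.C_mem_join c)))
  have := (finRotate J.ℓ).injective (J.C_injective (Subtype.ext (e1.trans e2.symm)))
  exact hc.2.2 (this ▸ ha)

end Biconnected

/-- The join is not colourable if no piece is. -/
theorem not_colourable_join {k : ℕ} (h : ∀ i, ¬ (J.D i).Colourable (J.D i).verts k) :
    ¬ J.join.Colourable J.join.verts k := by
  rintro ⟨φ, hφ⟩
  -- Were the colours different, the digon would not be monochromatic and `φ` would dicolour the
  -- piece.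
  have huv : ∀ i, φ (J.u i) = φ (J.v i) := by
    intro i
    by_contra hne
    refine h i ⟨φ, hφ.mono ?_⟩
    rintro a b ⟨hab, ha, hb, e⟩
    refine ⟨J.part_subset_join i ⟨hab, ?_⟩, J.verts_subset_join i ha, J.verts_subset_join i hb, e⟩
    rintro (he | he)
    · obtain ⟨rfl, rfl⟩ := Prod.mk.inj he
      exact hne e
    · obtain ⟨rfl, rfl⟩ := Prod.mk.inj he
      exact hne e.symm
  have hT : ∀ s t : J.treeVerts, φ s = φ t := by
    intro s t
    refine (J.isTree.connected.preconnected s t).induction_of_adj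
      (P := fun t : J.treeVerts => φ s = φ t)
      (fun a b hab ha => ha.trans ?_) rfl
    obtain ⟨i, hi⟩ := J.exists_edge hab
    rcases Sym2.eq_iff.1 hi with ⟨rfl, rfl⟩ | ⟨rfl, rfl⟩
    · exact huv i
    · exact (huv i).symm
  obtain ⟨j, -⟩ := J.exists_C_side ⟨0, J.n_pos⟩
  have key : ∀ m : ℕ, TransGen (J.join.MonoArc J.join.verts φ) (J.C j)
      (J.C ((finRotate J.ℓ ^ (m + 1)) j)) := by
    intro m
    have step : ∀ j, J.join.MonoArc J.join.verts φ (J.C j) (J.C (finRotate J.ℓ j)) := fun j =>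
      ⟨J.C_mem_join j, J.coe_mem_join _, J.coe_mem_join _, hT _ _⟩
    induction m with
    | zero => simpa using TransGen.single (step j)
    | succ m ih =>
      rw [pow_succ', Equiv.Perm.mul_apply]
      exact ih.tail (step _)
  -- Iterating the rotation as often as its order closes the monochromatic walk along `C`.
  have := key (orderOf (finRotate J.ℓ) - 1)
  rw [Nat.sub_add_cancel (orderOf_pos _), pow_orderOf_eq_one] at this
  exact hφ _ this

theorem hasSmallCuts_join {k : ℕ} (h : ∀ i, (J.D i).HasSmallCuts k) : J.join.HasSmallCuts k := by
  intro x hx y hy hxy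
  obtain ⟨i, hi⟩ := J.exists_retr_ne hx hy hxy
  obtain ⟨X, h1, h2, h3⟩ := h i _ (J.retr_mem i x) _ (J.retr_mem i y) hi
  exact ⟨J.retr i ⁻¹' X, h1, h2, (J.ncard_outArcs_preimage_le i X).trans h3⟩

theorem isExtremal_join {k : ℕ} (hk : 2 ≤ k) (h : ∀ i, (J.D i).IsExtremal k) :
    J.join.IsExtremal k := by
  have hk' : 0 < k := by omega
  have H : J.TwoArcConnected := fun i X h1 h2 => hk.trans ((h i).le_ncard_outArcs hk' h1 h2)
  have h' := fun i => (FinDigraph.isExtremal_iff hk').1 (h i)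
  exact (FinDigraph.isExtremal_iff hk').2 ⟨H.isBiconnected_join fun i => (h' i).1, H.isStrong_join,
    not_colourable_join fun i => (h' i).2.2.1, hasSmallCuts_join fun i => (h' i).2.2.2⟩

/-! ### From the join to the pieces -/

theorem le_ncard_outArcs_of_join {k : ℕ} (hk : 0 < k) (h : J.join.IsExtremal k) (i : Fin n)
    (X : Set α) (hX : ∃ x ∈ (J.D i).verts, x ∈ X) (hX' : ∃ y ∈ (J.D i).verts, y ∉ X) :
    k ≤ ((J.D i).outArcs X).ncard := by
  obtain ⟨x, hx, hxX⟩ := hX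
  obtain ⟨y, hy, hyX⟩ := hX'
  refine (h.le_ncard_outArcs hk (X := J.retr i ⁻¹' X) ⟨x, J.verts_subset_join i hx, ?_⟩
    ⟨y, J.verts_subset_join i hy, ?_⟩).trans (J.ncard_outArcs_preimage_le i X)
  · rwa [Set.mem_preimage, J.retr_of_mem hx]
  · rwa [Set.mem_preimage, J.retr_of_mem hy]

theorem isBiconnected_of_join (hJ : J.join.IsBiconnected) {i : Fin n} (hs : (J.D i).IsStrong) :
    (J.D i).IsBiconnected := by
  classical
  refine FinDigraph.isBiconnected_of_isStrong hs ⟨_, J.u_mem i⟩ fun z hz S hS b hb hbz => ?_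
  -- If `z` is an end of the tree edge, the vertices collapsed onto it survive in the join minus `z`
  -- and are attached to the other end through `C`; so `z` is redirected to that end. The preimage
  -- of `S` is then closed.
  let f : α → α := fun r => if r = z then (if (J.u i : α) = z then (J.v i : α) else J.u i) else r
  have hf : ∀ r, r ≠ z → f r = r := fun r h => if_neg h
  have hfS : ∀ p q : α, f p ∈ S → (p = J.u i ∧ q = J.v i) ∨ (p = J.v i ∧ q = J.u i) → f q ∈ S := by
    have huv := J.u_ne_v i
    have hadj : (J.D i).Adjacent (J.u i) (J.v i) := .inl (J.digon i).1
    by_cases hu : (J.u i : α) = z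
    · have h1 : f (J.u i) = J.v i := by simp [f, hu]
      have h2 : f (J.v i) = J.v i := hf _ fun h => huv (hu.trans h.symm)
      rintro p q hp (⟨rfl, rfl⟩ | ⟨rfl, rfl⟩)
      · rwa [h2, ← h1]
      · rwa [h1, ← h2]
    · have h1 : f (J.u i) = J.u i := hf _ hu
      by_cases hv : (J.v i : α) = z
      · have h2 : f (J.v i) = J.u i := by simp [f, hv, hu]
        rintro p q hp (⟨rfl, rfl⟩ | ⟨rfl, rfl⟩)
        · rwa [h2, ← h1]
        · rwa [h1, ← h2]
      · have h2 : f (J.v i) = J.v i := hf _ hv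
        rintro p q hp (⟨rfl, rfl⟩ | ⟨rfl, rfl⟩)
        · rw [h1] at hp; rw [h2]; exact hS.closed _ hp _ hv hadj
        · rw [h2] at hp; rw [h1]; exact hS.closed _ hp _ hu hadj.symm
  have hfmem : ∀ w ∈ (J.D i).verts, w ≠ z → f (J.retr i w) = w := fun w hw hwz => by
    rw [J.retr_of_mem hw, hf w hwz]
  have hS' : J.join.IsClosedAvoiding z {w | w ∈ J.join.verts ∧ w ≠ z ∧ f (J.retr i w) ∈ S} := by
    refine ⟨fun w hw => hw.1, ?_, fun h => h.2.1 rfl, ?_⟩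
    · obtain ⟨w, hw⟩ := hS.nonempty
      have hwz : w ≠ z := fun h => hS.notMem (h ▸ hw)
      exact ⟨w, J.verts_subset_join i (hS.subset hw), hwz, by
        rwa [hfmem w (hS.subset hw) hwz]⟩
    · rintro c ⟨hc, hcz, hcS⟩ d hdz hcd
      refine ⟨hcd.mem.2, hdz, ?_⟩
      have hpart : c ∈ (J.D i).verts → d ∈ (J.D i).verts → (J.D i).Adjacent c d →
          f (J.retr i d) ∈ S := fun h1 h2 h => by
        rw [hfmem c h1 hcz] at hcS
        rw [hfmem d h2 hdz]
        exact hS.closed c hcS d hdz h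
      rcases hcd with hcd | hdc
      · rcases J.join_arc_cases i hcd with h | ⟨h, -, -⟩ | ⟨j, -, h⟩
        · rwa [← show J.retr i c = J.retr i d from h]
        · exact hpart (J.part_mem h).1 (J.part_mem h).2 (.inl h.1)
        · exact hfS _ _ hcS (h.imp (fun h => h.2.2) fun h => h.2.2)
      · rcases J.join_arc_cases i hdc with h | ⟨h, -, -⟩ | ⟨j, -, h⟩
        · rwa [show J.retr i d = J.retr i c from h]
        · exact hpart (J.part_mem h).2 (J.part_mem h).1 (.inr h.1)
        · exact hfS _ _ hcS (h.symm.imp (fun h => h.2.2.symm) fun h => h.2.2.symm)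
  have := (hJ.eq_of_isClosedAvoiding (J.verts_subset_join i hz) hS' (J.verts_subset_join i hb)
    hbz).2.2
  rwa [hfmem b hb hbz] at this

/-- A cut of the join that separates `uᵢ` from `vᵢ` has an arc outside `Dᵢ - [uᵢ, vᵢ]`. -/
theorem TwoArcConnected.exists_arc_leaving (H : J.TwoArcConnected) {i : Fin n} {X : Set α}
    (hX : ((J.u i : α) ∈ X ∧ (J.v i : α) ∉ X) ∨ ((J.v i : α) ∈ X ∧ (J.u i : α) ∉ X)) :
    ∃ e ∈ J.join.outArcs X, e ∉ J.part i := by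
  by_contra! hno
  -- Were all leaving arcs in `part i`, then `X` would be closed along all other tree edges and
  -- along `C`, which together connect the two ends in both directions. An arc also in another piece
  -- would join two tree vertices, which `part_ne_coe` excludes.
  have hedge : ∀ a b, (J.T.deleteEdges {s(J.u i, J.v i)}).Adj a b → (a : α) ∈ X → (b : α) ∈ X := by
    intro a b hab ha
    rw [SimpleGraph.deleteEdges_adj] at hab
    obtain ⟨l, hl, h1, h2⟩ := J.exists_edge_mem hab.1
    have hli : l ≠ i := by
      rintro rfl
      exact hab.2 hl.symm
    refine H.mem_of_closed (fun e he h => ?_) h1 ha h2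
    by_contra h'
    have hei := hno e ⟨J.part_subset_join l he, h, h'⟩
    obtain ⟨s, hs⟩ := J.exists_coe_of_mem_mem hli (J.part_mem he).1 (J.part_mem hei).1
    obtain ⟨t, ht⟩ := J.exists_coe_of_mem_mem hli (J.part_mem he).2 (J.part_mem hei).2
    exact part_ne_coe hei s t (by rw [hs, ht])
  have hC : ∀ j, (J.C j : α) ∈ X → (J.C (finRotate J.ℓ j) : α) ∈ X := by
    intro j hj
    by_contra hj'
    exact part_ne_coe (hno _ ⟨J.C_mem_join j, hj, hj'⟩) _ _ rfl
  rcases hX with ⟨hu, hv⟩ | ⟨hv, hu⟩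
  · obtain ⟨j, h1, h2⟩ := J.exists_C_crossing i
    have h3 := hC j (SimpleGraph.Reachable.induction_of_adj h1
      (P := fun t : J.treeVerts => (t : α) ∈ X) hedge hu)
    exact hv ((J.not_side_iff.1 h2).symm.induction_of_adj
      (P := fun t : J.treeVerts => (t : α) ∈ X) hedge h3)
  · obtain ⟨j, h1, h2⟩ := J.exists_C_crossing' i
    have h3 := hC j ((J.not_side_iff.1 h1).induction_of_adj
      (P := fun t : J.treeVerts => (t : α) ∈ X) hedge hv)
    exact hu (SimpleGraph.Reachable.induction_of_adj (SimpleGraph.Reachable.symm h2)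

      (P := fun t : J.treeVerts => (t : α) ∈ X) hedge h3)

/-- At most one arc of the digon lies in the cut, and `exists_arc_leaving` supplies a substitute for
it. -/
theorem TwoArcConnected.ncard_outArcs_le (H : J.TwoArcConnected) (i : Fin n) (X : Set α) :
    ((J.D i).outArcs X).ncard ≤ (J.join.outArcs X).ncard := by
  set Q : Set (α × α) := {e ∈ J.part i | e.1 ∈ X ∧ e.2 ∉ X} with hQ
  have hQJ : Q ⊆ J.join.outArcs X := fun e he => ⟨J.part_subset_join i he.1, he.2⟩
  have hQf : Q.Finite := (J.join.finite_outArcs X).subset hQJ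
  by_cases hX : ((J.u i : α) ∈ X ∧ (J.v i : α) ∉ X) ∨ ((J.v i : α) ∈ X ∧ (J.u i : α) ∉ X)
  · obtain ⟨e, he, heQ⟩ := H.exists_arc_leaving hX
    obtain ⟨p, hp⟩ : ∃ p, (J.D i).outArcs X ⊆ insert p Q := by
      rcases hX with ⟨hu, hv⟩ | ⟨hv, hu⟩
      · refine ⟨(J.u i, J.v i), fun e he => ?_⟩
        by_cases h : e = ((J.u i : α), (J.v i : α))
        · exact .inl h
        · refine .inr ⟨⟨he.1, ?_⟩, he.2⟩
          rintro (h' | rfl)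
          · exact h h'
          · exact he.2.2 hu
      · refine ⟨(J.v i, J.u i), fun e he => ?_⟩
        by_cases h : e = ((J.v i : α), (J.u i : α))
        · exact .inl h
        · refine .inr ⟨⟨he.1, ?_⟩, he.2⟩
          rintro (rfl | h')
          · exact he.2.2 hv
          · exact h h'
    calc ((J.D i).outArcs X).ncard ≤ (insert p Q).ncard := Set.ncard_le_ncard hp (hQf.insert p)
      _ ≤ Q.ncard + 1 := Set.ncard_insert_le p Q
      _ = (insert e Q).ncard := (Set.ncard_insert_of_notMem (fun h => heQ h.1) hQf).symm
      _ ≤ _ := Set.ncard_le_ncard (Set.insert_subset he hQJ) (J.join.finite_outArcs X)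
  · refine Set.ncard_le_ncard (fun e he => hQJ ⟨⟨he.1, ?_⟩, he.2⟩) (J.join.finite_outArcs X)
    rintro (rfl | rfl)
    · exact hX (.inl he.2)
    · exact hX (.inr he.2)

/-- If a piece is colourable and both sides of its edge are colourable, then so is the join. -/
theorem colourable_join {k : ℕ} (hk : 3 ≤ k) {i : Fin n}
    (hi : (J.D i).Colourable (J.D i).verts k)
    (hu : J.join.Colourable {w ∈ J.join.verts | J.retr i w = J.u i} k)
    (hv : J.join.Colourable {w ∈ J.join.verts | J.retr i w = J.v i} k) :
    J.join.Colourable J.join.verts k := by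
  classical
  obtain ⟨φ, hφ⟩ := hi
  obtain ⟨φu, hφu⟩ := hu
  obtain ⟨φv, hφv⟩ := hv
  have hne : φ (J.u i) ≠ φ (J.v i) := fun h => hφ (J.u i) <| .head
    ⟨(J.digon i).1, J.u_mem i, J.v_mem i, h⟩ (.single ⟨(J.digon i).2, J.v_mem i, J.u_mem i, h.symm⟩)
  obtain ⟨j, hj1, hj2⟩ := J.exists_C_crossing i
  -- Both sides are recoloured to agree with `φ` at `uᵢ` and `vᵢ`. Keeping the tail of the crossing
  -- arc off the colour of `vᵢ` is what then lets `τ` make that arc non-monochromatic.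
  obtain ⟨σ, hσ, hσ'⟩ := exists_perm_apply_eq_apply_ne hk (φu (J.u i)) (φu (J.C j)) hne
  obtain ⟨τ, hτ, hτ'⟩ := exists_perm_apply_eq_apply_ne hk (φv (J.v i))
    (φv (J.C (finRotate J.ℓ j))) hσ'.symm
  let ψ : α → Fin k := fun w => if w ∈ (J.D i).verts then φ w
    else if J.retr i w = J.u i then σ (φu w) else τ (φv w)
  have hψi : ∀ w ∈ (J.D i).verts, ψ w = φ w := fun w hw => if_pos hw
  have hψu : ∀ w, J.retr i w = J.u i → ψ w = σ (φu w) := by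
    intro w hw
    by_cases hwi : w ∈ (J.D i).verts
    · rw [J.retr_of_mem hwi] at hw
      rw [hψi w hwi, hw, hσ]
    · simp only [ψ, if_neg hwi, if_pos hw]
  have hψv : ∀ w, J.retr i w = J.v i → ψ w = τ (φv w) := by
    intro w hw
    by_cases hwi : w ∈ (J.D i).verts
    · rw [J.retr_of_mem hwi] at hw
      rw [hψi w hwi, hw, hτ]
    · simp only [ψ, if_neg hwi, hw, if_neg (J.u_ne_v i).symm]
  have hψj : ψ (J.C j) ≠ ψ (J.C (finRotate J.ℓ j)) := by
    rw [hψu _ (J.retr_coe_eq_u.2 hj1), hψv _ (J.retr_coe_eq_v.2 hj2)]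
    exact hτ'.symm
  have huv : ¬ ReflTransGen ((J.D i).MonoArc (J.D i).verts φ) (J.u i) (J.v i) := by
    have : ∀ w, ReflTransGen ((J.D i).MonoArc (J.D i).verts φ) (J.u i) w → φ (J.u i) = φ w := by
      intro w hw
      induction hw with
      | refl => rfl
      | tail _ h ih => exact ih.trans h.2.2.2
    exact fun h => hne (this _ h)
  -- Monochromatic arcs that are not collapsed project to monochromatic arcs of the piece or, for
  -- the other crossing arc of `C`, to the pair `(vᵢ, uᵢ)`. Adding this pair closes no cycle, as
  -- monochromatic walks from `uᵢ` miss `vᵢ`.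
  refine ⟨ψ, AcyclicRel.of_fibres (J.retr i) (hφ.add_pair huv) ?_ ?_⟩
  · rintro a b ⟨hab, -, -, e⟩
    rcases J.join_arc_cases i hab with h | ⟨h, h1, h2⟩ | ⟨j', hj', h⟩
    · exact .inl h
    · have ha := (J.part_mem h).1
      have hb := (J.part_mem h).2
      simp only at h1 h2 ha hb
      rw [h1, h2]
      rw [hψi a ha, hψi b hb] at e
      exact .inr (.inl ⟨h.1, ha, hb, e⟩)
    · rcases h with ⟨h1, h2, -, -⟩ | ⟨-, -, h3, h4⟩
      · obtain rfl := J.C_crossing_unique hj1 hj2 h1 h2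
        obtain ⟨rfl, rfl⟩ := Prod.mk.inj hj'
        exact absurd e hψj
      · exact .inr (.inr ⟨h3, h4⟩)
  -- The fibres over `uᵢ` and `vᵢ` carry the recoloured side colourings; all other fibres are single
  -- vertices.
  · refine AcyclicRel.of_closed (X := {w | J.retr i w = J.u i})
      (fun a b h ha => h.2.symm.trans ha) (hφu.mono ?_)
      (AcyclicRel.of_closed (X := {w | J.retr i w = J.v i})
        (fun a b h ha => h.1.2.symm.trans ha) (hφv.mono ?_) ?_)
    · rintro a b ⟨⟨⟨hab, ha, hb, e⟩, -⟩, hau, hbu⟩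
      rw [hψu a hau, hψu b hbu] at e
      exact ⟨hab, ⟨ha, hau⟩, ⟨hb, hbu⟩, σ.injective e⟩
    · rintro a b ⟨⟨⟨⟨hab, ha, hb, e⟩, -⟩, -⟩, hav, hbv⟩
      rw [hψv a hav, hψv b hbv] at e
      exact ⟨hab, ⟨ha, hav⟩, ⟨hb, hbv⟩, τ.injective e⟩
    · intro a ha
      obtain ⟨b, ⟨⟨⟨hab, hr⟩, hau, hbu⟩, hav, hbv⟩, -⟩ := TransGen.head'_iff.1 ha
      have mem : ∀ w, J.retr i w ≠ J.u i → J.retr i w ≠ J.v i → w ∈ (J.D i).verts := by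
        intro w h1 h2
        by_contra h
        exact (J.retr_of_notMem h).elim h1 h2
      rw [J.retr_of_mem (mem a hau hav), J.retr_of_mem (mem b hbu hbv)] at hr
      exact J.join.loopless _ hab.1 hr

theorem isExtremal_of_join {k : ℕ} (hk : 3 ≤ k) (h : J.join.IsExtremal k) (i : Fin n) :
    (J.D i).IsExtremal k := by
  have hk' : 0 < k := by omega
  have hcut := le_ncard_outArcs_of_join hk' h
  have H : J.TwoArcConnected := fun i X h1 h2 => le_trans (by omega) (hcut i X h1 h2)
  obtain ⟨hb, -, -, hsmall⟩ := (FinDigraph.isExtremal_iff hk').1 h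
  have hcrit := h.isCritical hk'
  have hs : (J.D i).IsStrong := FinDigraph.isStrong_of_outArcs_nonempty fun X h1 h2 =>
    Set.nonempty_of_ncard_ne_zero (by have := hcut i X h1 h2; omega)
  refine (FinDigraph.isExtremal_iff hk').2 ⟨isBiconnected_of_join hb hs, hs, fun hc => ?_, ?_⟩
  -- Each side misses the opposite end of the tree edge, so it is a proper subset of a critical set.
  · refine hcrit.not_colourable (colourable_join hk hc (hcrit.colourable _ ?_)
      (hcrit.colourable _ ?_))
    · refine ⟨fun w hw => hw.1, fun hsub => J.u_ne_v i ?_⟩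
      have := (hsub (J.coe_mem_join (J.v i))).2
      rw [J.retr_of_mem (J.v_mem i)] at this
      exact this.symm
    · refine ⟨fun w hw => hw.1, fun hsub => J.u_ne_v i ?_⟩
      have := (hsub (J.coe_mem_join (J.u i))).2
      rwa [J.retr_of_mem (J.u_mem i)] at this
  · intro x hx y hy hxy
    obtain ⟨X, h1, h2, h3⟩ := hsmall x (J.verts_subset_join i hx) y (J.verts_subset_join i hy) hxy
    exact ⟨X, h1, h2, (H.ncard_outArcs_le i X).trans h3⟩

end HajosTree

theorem lemma6p7 {α : Type*} {n : ℕ} (k : ℕ) (hk : 2 ≤ k) (J : HajosTree α n) :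
    ((∀ i, (J.D i).IsExtremal k) → J.join.IsExtremal k) ∧
      (3 ≤ k → J.join.IsExtremal k → ∀ i, (J.D i).IsExtremal k) :=
  ⟨HajosTree.isExtremal_join hk, fun hk' h i => HajosTree.isExtremal_of_join hk' h i⟩
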